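/- For $z\in\mathbb C$ let $[z]_i$ be the Gaussian integer nearest to $z$, ties being rounded down in the real and in the imaginary part. Let $B=\{x+iy:-\frac12\le x,y<\frac12\}$, let $Tz=\frac1z-\left[\frac1z\right]_i$ for $z\ne 0$ and $T0=0$ (the Hurwitz map; it sends Lebesgue-almost every point of $B$ into $B$), and let $a_1(z)=\left[\frac1{z-[z]_i}\right]_i$ (with $a_1(z)=0$ if $z=[z]_i$) be the first digit of the Hurwitz continued fraction of $z$. There is a unique Borel probability measure $\mu$ on $\mathbb C$ that is carried by $B$, absolutely continuous with respect to Lebesgue measure, and $T$-invariant. This measure has a density $\rho\ge 0$ on $B$ with respect to Lebesgue measure that is continuous on the interior of $B$ off the eight circles $|z\pm1|=1$, $|z\pm i|=1$, $|z\pm1\pm i|=1$. For $s,t\in\{1,-1\}$ let $$A_{s,t}=\{z\in \operatorname{int}B:\ |z-s|<1,\ |z-ti|<1,\ |z-s-ti|>1\}$$ (four of the twelve regions into which the circles dissect the interior of $B$). The limit $$\tilde C=\lim_{A_{s,t}\ni z\to0}\rho(z)$$ exists and is the same for all four choices of $s,t$, and with the constant $H=\pi\tilde C>0$ one has $$\mu\{z\in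 B:\ |a_1(z)|>j\}=\frac{H}{j^2}+O\!\left(\frac1{j^3}\right)\qquad\text{as } j\to\infty,\ j\in\mathbb R .$$ -/

import Mathlib

open MeasureTheory Filter Topology Complex

noncomputable section

/-- The Gaussian integer nearest to `z`, as a complex number; ties are broken by rounding down in
both the real and the imaginary part (`⌈x - 1/2⌉` is the integer nearest to `x`, and equals `a`
for `x = a + 1/2`). -/
def nearestGaussian (z : ℂ) : ℂ :=
  (⌈z.re - 1 / 2⌉ : ℂ) + (⌈z.im - 1 / 2⌉ : ℂ) * I

/-- The unit square `B = {x + iy : -1/2 ≤ x, y < 1/2}`. -/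
def hurwitzSquare : Set ℂ :=
  {z : ℂ | (-(1 / 2) ≤ z.re ∧ z.re < 1 / 2) ∧ (-(1 / 2) ≤ z.im ∧ z.im < 1 / 2)}

/-- The Hurwitz map `T z = 1/z - [1/z]`, with `T 0 = 0`. It is written on all of `ℂ`; Lebesgue
almost every point of `B` is mapped into `B`, the exceptions being among the ties of the rounding
convention. -/
def hurwitzMap (z : ℂ) : ℂ :=
  1 / z - nearestGaussian (1 / z)

/-- The digits of the Hurwitz continued fraction of `z`: `a₀ = [z]`, and
`a_{k+1} = [1 / T^k z₀]` with `z₀ = z - [z]`. -/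
def hurwitzDigit (z : ℂ) : ℕ → ℂ
  | 0 => nearestGaussian z
  | k + 1 => nearestGaussian (1 / hurwitzMap^[k] (z - nearestGaussian z))

/-- `μ` is a Borel probability measure carried by `B`, absolutely continuous with respect to
Lebesgue measure and invariant under the Hurwitz map. -/
structure IsHurwitzMeasure (μ : Measure ℂ) : Prop where
  isProbabilityMeasure : IsProbabilityMeasure μ
  carried : μ hurwitzSquareᶜ = 0
  absolutelyContinuous : μ ≪ volume
  invariant : MeasurePreserving hurwitzMap μ μ

/-- The interior of `B` with the circles `|z ± 1| = 1`, `|z ± i| = 1`, `|z ± 1 ± i| = 1` removed,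
that is, the unit circles about the eight nonzero Gaussian integers `m + ni` with
`m, n ∈ {-1, 0, 1}`. -/
def dissectedSquare : Set ℂ :=
  {z ∈ interior hurwitzSquare | ∀ m ∈ ({-1, 0, 1} : Set ℝ), ∀ n ∈ ({-1, 0, 1} : Set ℝ),
    (m, n) ≠ (0, 0) → ‖z - ((m : ℂ) + (n : ℂ) * I)‖ ≠ 1}

/-- For signs `s, t ∈ {1, -1}`: the component of the dissected square that reaches `0` inside the
quadrant with signs `(s, t)`. It is the part of the interior of `B` that lies in the open unit
disks about `s` and about `ti`, and outside the closed unit disk about `s + ti`. -/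
def quadrantRegion (s t : ℝ) : Set ℂ :=
  {z ∈ interior hurwitzSquare | ‖z - (s : ℂ)‖ < 1 ∧ ‖z - (t : ℂ) * I‖ < 1 ∧
    1 < ‖z - ((s : ℂ) + (t : ℂ) * I)‖}

/-- `ρ` is a density of `μ` on `B` with respect to Lebesgue measure, in the version that is
continuous off the eight circles (such a version is determined on the dissected square). -/
structure IsHurwitzDensity (μ : Measure ℂ) (ρ : ℂ → ℝ) : Prop where
  measurable : Measurable ρ
  nonneg : ∀ z, 0 ≤ ρ z
  eq_withDensity :
    μ = (volume.restrict hurwitzSquare).withDensity (fun z => ENNReal.ofReal (ρ z))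
  continuousOn : ContinuousOn ρ dissectedSquare

end

/-! ### The dissected square and its cells -/

/-! The unit circles about the Gaussian integers cut the square into twelve cells, and this
partition is Markov for the Hurwitz map. Inversion permutes the circles and half-integer grid lines
involved. Hence an inverse branch `z ↦ 1 / (p + z)` is admissible on a whole cell or nowhere on it
(`SameCell.branch_mem`), and it carries a cell into a single cell (`SameCell.branch`).

Admissible branches contract distances by a factor 2 and have bounded distortion, so the transfer
operator preserves the positive functions that are log-Lipschitz on each cell
(`LogLipschitz.transfer`). Moreover every cell contains the image of the whole square under some
composition of two branches with small digits (`exists_two_branches`). The second iterate of the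
operator is therefore bounded below by a fixed multiple of the integral, a Doeblin condition
(`LogLipschitz.minorant_mul_le`). Splitting off half of this lower bound leaves a remainder in the
same class with smaller mass, which gives geometric contraction in the uniform norm
(`LogLipschitz.transfer_iterate_le`).

The iterates of the constant 1 converge uniformly to an invariant density, bounded away from 0 and
Lipschitz on each cell. For uniqueness, the density of any other invariant measure is approximated
in L¹ by Lipschitz functions, whose iterates converge to multiples of this density
(`IsHurwitzMeasure.le_hurwitzMeasure`).

Each quadrant region lies in one cell, so the density has a limit at 0 along it; rotation by `i`
commutes with the dynamics, so the four limits agree, and the lower bound makes them positive. The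
quadrant regions fill the disk of radius `r` up to area `O(r ^ 3)`, so the disk has measure `π C r ^
2 + O(r ^ 3)`. The event `|a₁| > j` lies, almost everywhere, between the disks of radii `1 / (j +
1)` and `1 / (j - 1)`. -/

lemma interior_hurwitzSquare :
    interior hurwitzSquare = {z : ℂ | |z.re| < 1 / 2 ∧ |z.im| < 1 / 2} := by
  have h : hurwitzSquare = Set.Ico (-(1 / 2) : ℝ) (1 / 2) ×ℂ Set.Ico (-(1 / 2) : ℝ) (1 / 2) := by
    ext z
    simp [hurwitzSquare, mem_reProdIm]
  rw [h, interior_reProdIm, interior_Ico]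
  ext z
  simp [mem_reProdIm, abs_lt]

/-- The Gaussian integer `m + ni`. -/
noncomputable def latticePoint (p : ℤ × ℤ) : ℂ := (p.1 : ℂ) + (p.2 : ℂ) * I

@[simp] lemma latticePoint_re (p : ℤ × ℤ) : (latticePoint p).re = p.1 := by simp [latticePoint]

@[simp] lemma latticePoint_im (p : ℤ × ℤ) : (latticePoint p).im = p.2 := by simp [latticePoint]

/-- The squared distance from `z` to the Gaussian integer `m + ni`. -/
def latticeDistSq (z : ℂ) (m n : ℤ) : ℝ := (z.re - m) ^ 2 + (z.im - n) ^ 2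

lemma norm_sq_eq (z : ℂ) : ‖z‖ ^ 2 = z.re ^ 2 + z.im ^ 2 := by
  rw [← normSq_eq_norm_sq, normSq_apply]; ring

lemma norm_eq_one_iff_sq (z : ℂ) : ‖z‖ = 1 ↔ z.re ^ 2 + z.im ^ 2 = 1 := by
  rw [← norm_sq_eq, pow_eq_one_iff_of_nonneg (norm_nonneg z) two_ne_zero]

lemma norm_lt_one_iff_sq (z : ℂ) : ‖z‖ < 1 ↔ z.re ^ 2 + z.im ^ 2 < 1 := by
  rw [← norm_sq_eq, sq_lt_one_iff₀ (norm_nonneg z)]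

lemma one_lt_norm_iff_sq (z : ℂ) : 1 < ‖z‖ ↔ 1 < z.re ^ 2 + z.im ^ 2 := by
  rw [← norm_sq_eq, one_lt_sq_iff₀ (norm_nonneg z)]

lemma abs_le_one_of_sq_le {x : ℝ} {m : ℤ} (hx : |x| < 1 / 2) (h : (x - m) ^ 2 ≤ 1) :
    -1 ≤ m ∧ m ≤ 1 := by
  obtain ⟨h1, h2⟩ := abs_lt.1 hx
  have h3 := abs_le.1 ((sq_le_one_iff_abs_le_one _).1 h)
  have h4 : (m : ℝ) < 2 := by linarith
  have h5 : (-2 : ℝ) < m := by linarith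
  have h6 : m < 2 := by exact_mod_cast h4
  have h7 : -2 < m := by exact_mod_cast h5
  omega

lemma latticeDistSq_le_one {z : ℂ} (h1 : |z.re| < 1 / 2) (h2 : |z.im| < 1 / 2) {m n : ℤ}
    (h : latticeDistSq z m n ≤ 1) : (-1 ≤ m ∧ m ≤ 1) ∧ (-1 ≤ n ∧ n ≤ 1) := by
  unfold latticeDistSq at h
  exact ⟨abs_le_one_of_sq_le h1 (by nlinarith [sq_nonneg (z.im - n)]),
    abs_le_one_of_sq_le h2 (by nlinarith [sq_nonneg (z.re - m)])⟩

lemma mem_dissectedSquare_iff {z : ℂ} : z ∈ dissectedSquare ↔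
    |z.re| < 1 / 2 ∧ |z.im| < 1 / 2 ∧ ∀ m n : ℤ, latticeDistSq z m n ≠ 1 := by
  have key (m n : ℝ) : ‖z - ((m : ℂ) + (n : ℂ) * I)‖ = 1 ↔
      (z.re - m) ^ 2 + (z.im - n) ^ 2 = 1 := by
    rw [norm_eq_one_iff_sq]; simp
  unfold dissectedSquare
  rw [interior_hurwitzSquare]
  simp only [Set.mem_ofPred_eq, and_assoc]
  refine and_congr_right fun h1 => and_congr_right fun h2 => ⟨fun h m n hmn => ?_, ?_⟩
  · obtain ⟨⟨hm1, hm2⟩, hn1, hn2⟩ := latticeDistSq_le_one h1 h2 hmn.le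
    by_cases h0 : m = 0 ∧ n = 0
    · obtain ⟨rfl, rfl⟩ := h0
      obtain ⟨h3, h4⟩ := abs_lt.1 h1
      obtain ⟨h5, h6⟩ := abs_lt.1 h2
      unfold latticeDistSq at hmn
      push_cast at hmn
      nlinarith
    · refine h m ?_ n ?_ ?_ ((key m n).2 hmn)
      · interval_cases m <;> simp
      · interval_cases n <;> simp
      · simpa using h0
  · intro h m hm n hn _ hmn
    rw [key] at hmn
    simp only [Set.mem_insert_iff, Set.mem_singleton_iff] at hm hn
    obtain ⟨m', rfl⟩ : ∃ m' : ℤ, m = m' := by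
      rcases hm with rfl | rfl | rfl
      exacts [⟨-1, by simp⟩, ⟨0, by simp⟩, ⟨1, by simp⟩]
    obtain ⟨n', rfl⟩ : ∃ n' : ℤ, n = n' := by
      rcases hn with rfl | rfl | rfl
      exacts [⟨-1, by simp⟩, ⟨0, by simp⟩, ⟨1, by simp⟩]
    exact h m' n' hmn

/-! ### Cells and inverse branches -/

/-- Two points of the square lie in the same cell if no unit circle about a Gaussian integer
separates them. -/
def SameCell (z z' : ℂ) : Prop :=
  ∀ m n : ℤ, latticeDistSq z m n < 1 ↔ latticeDistSq z' m n < 1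

lemma SameCell.symm {z z' : ℂ} (h : SameCell z z') : SameCell z' z := fun m n => (h m n).symm

/-- The inverse branch of the Hurwitz map with digit `p`. -/
noncomputable def branch (p : ℤ × ℤ) (z : ℂ) : ℂ := (latticePoint p + z)⁻¹

/-- Under inversion the unit circle about `m + ni` becomes a half-integer grid line if `m² + n² =
1`, and the unit circle about the conjugate `m - ni` if `m² + n² = 2`. Multiplying by `|u|²` makes
the equation polynomial in `u`. -/
lemma inv_latticeDistSq {u : ℂ} (hu : u ≠ 0) (m n : ℤ) :
    (latticeDistSq u⁻¹ m n - 1) * normSq u =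
      1 - 2 * m * u.re + 2 * n * u.im + ((m : ℝ) ^ 2 + (n : ℝ) ^ 2 - 1) * normSq u := by
  have h : normSq u ≠ 0 := by simpa using hu
  have h2 : normSq u = u.re ^ 2 + u.im ^ 2 := by rw [normSq_apply]; ring
  unfold latticeDistSq
  rw [inv_re, inv_im]
  field_simp
  generalize hN : normSq u = N at *
  linear_combination -h2

lemma inv_latticeDistSq_lt {u : ℂ} (hu : u ≠ 0) (m n : ℤ) :
    latticeDistSq u⁻¹ m n < 1 ↔
      1 - 2 * m * u.re + 2 * n * u.im + ((m : ℝ) ^ 2 + (n : ℝ) ^ 2 - 1) * normSq u < 0 := by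
  have h : 0 < normSq u := normSq_pos.2 hu
  rw [← inv_latticeDistSq hu]
  constructor
  · intro h1; nlinarith
  · intro h1; by_contra h2; nlinarith [mul_nonneg (sub_nonneg.2 (not_lt.1 h2)) h.le]

lemma inv_mem_square_iff {u : ℂ} (hu : u ≠ 0) : (|u⁻¹.re| < 1 / 2 ∧ |u⁻¹.im| < 1 / 2) ↔
    (2 * u.re < normSq u ∧ -(2 * u.re) < normSq u) ∧
      (2 * u.im < normSq u ∧ -(2 * u.im) < normSq u) := by
  have h : 0 < normSq u := normSq_pos.2 hu
  rw [inv_re, inv_im, abs_div, abs_div, abs_of_pos h, div_lt_iff₀ h, div_lt_iff₀ h, abs_neg,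
    abs_lt, abs_lt]
  constructor
  · rintro ⟨⟨h1, h2⟩, h3, h4⟩
    refine ⟨⟨?_, ?_⟩, ?_, ?_⟩ <;> linarith
  · rintro ⟨⟨h1, h2⟩, h3, h4⟩
    refine ⟨⟨?_, ?_⟩, ?_, ?_⟩ <;> linarith

lemma two_mul_ne_odd {x : ℝ} (hx : |x| < 1 / 2) (a k : ℤ) (hk : k = 1 ∨ k = -1) :
    2 * (a + x) ≠ k := by
  intro h
  obtain ⟨h1, h2⟩ := abs_lt.1 hx
  have h3 : ((k - 2 * a : ℤ) : ℝ) < 1 := by push_cast; linarith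
  have h4 : (-1 : ℝ) < ((k - 2 * a : ℤ) : ℝ) := by push_cast; linarith
  have h5 : k - 2 * a < 1 := by exact_mod_cast h3
  have h6 : -1 < k - 2 * a := by exact_mod_cast h4
  omega

/-- A translate of the open square by a Gaussian integer lies on one side of each half-integer grid
line, so the digit alone decides the side. -/
lemma one_lt_two_mul_of_abs_lt {x x' : ℝ} (hx : |x| < 1 / 2) (hx' : |x'| < 1 / 2) (a k : ℤ)
    (hk : k = 1 ∨ k = -1) : 1 < 2 * k * (a + x) → 1 < 2 * k * (a + x') := by
  intro h
  obtain ⟨h1, h2⟩ := abs_lt.1 hx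
  obtain ⟨h3, h4⟩ := abs_lt.1 hx'
  rcases hk with rfl | rfl
  · push_cast at *
    have h5 : (0 : ℝ) < a := by linarith
    have h6 : (1 : ℝ) ≤ a := by exact_mod_cast h5
    linarith
  · push_cast at *
    have h5 : (a : ℝ) < 0 := by linarith
    have h6 : (a : ℝ) ≤ -1 := by
      have : a < 0 := by exact_mod_cast h5
      have : a ≤ -1 := by omega
      exact_mod_cast this
    linarith

lemma ne_zero_of_mem {z : ℂ} (hz : z ∈ dissectedSquare) (p : ℤ × ℤ) : latticePoint p + z ≠ 0 := by
  intro h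
  have hz' : z = -latticePoint p := by linear_combination h
  obtain ⟨h1, h2, h3⟩ := mem_dissectedSquare_iff.1 hz
  have := h3 (-p.1 + 1) (-p.2)
  apply this
  simp [hz', latticeDistSq]

lemma normSq_latticePoint_add (z : ℂ) (p : ℤ × ℤ) :
    normSq (latticePoint p + z) = (p.1 + z.re) ^ 2 + (p.2 + z.im) ^ 2 := by
  rw [normSq_apply]; simp; ring

/-- A circle through the image would pull back to a half-integer line, which `p + z` avoids because
`z` is in the open square, or to a unit circle about a Gaussian integer, which it avoids because `z`
does. -/
lemma branch_mem {z : ℂ} (hz : z ∈ dissectedSquare) {p : ℤ × ℤ}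
    (h : |(branch p z).re| < 1 / 2 ∧ |(branch p z).im| < 1 / 2) :
    branch p z ∈ dissectedSquare := by
  refine mem_dissectedSquare_iff.2 ⟨h.1, h.2, fun m n hmn => ?_⟩
  have hu := ne_zero_of_mem hz p
  obtain ⟨hz1, hz2, hz3⟩ := mem_dissectedSquare_iff.1 hz
  obtain ⟨⟨hm1, hm2⟩, hn1, hn2⟩ := latticeDistSq_le_one h.1 h.2 hmn.le
  have key := inv_latticeDistSq hu m n
  rw [show (latticePoint p + z)⁻¹ = branch p z from rfl, hmn, normSq_latticePoint_add] at key
  simp only [add_re, add_im, latticePoint_re, latticePoint_im] at key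
  have e1 := two_mul_ne_odd hz1 p.1 1 (by simp)
  have e2 := two_mul_ne_odd hz1 p.1 (-1) (by simp)
  have e3 := two_mul_ne_odd hz2 p.2 1 (by simp)
  have e4 := two_mul_ne_odd hz2 p.2 (-1) (by simp)
  have e5 := hz3 (m - p.1) (-n - p.2)
  unfold latticeDistSq at e5
  push_cast at e1 e2 e3 e4 e5
  interval_cases m <;> interval_cases n <;> push_cast at key e5 <;>
    first
    | exact e1 (by linarith)
    | exact e2 (by linarith)
    | exact e3 (by linarith)
    | exact e4 (by linarith)
    | exact e5 (by linarith)

lemma two_mul_lt_normSq_iff {z : ℂ} (p : ℤ × ℤ) (m n : ℤ)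
    (hmn : (m : ℝ) ^ 2 + (n : ℝ) ^ 2 = 1) (h : latticeDistSq z (m - p.1) (n - p.2) ≠ 1) :
    2 * (m * (p.1 + z.re) + n * (p.2 + z.im)) < normSq (latticePoint p + z) ↔
      ¬ latticeDistSq z (m - p.1) (n - p.2) < 1 := by
  rw [normSq_latticePoint_add]
  unfold latticeDistSq at *
  push_cast at *
  constructor
  · intro h1 h2
    nlinarith
  · intro h1
    have h3 := lt_of_le_of_ne (not_lt.1 h1) (Ne.symm h)
    nlinarith

/-- Inversion turns the four sides of the square into the unit circles about `±1` and `±i`;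
translating by `-p` gives circles of the dissection. Admissibility of a digit thus depends only on
the cell. -/
lemma branch_mem_iff {z : ℂ} (hz : z ∈ dissectedSquare) (p : ℤ × ℤ) :
    branch p z ∈ dissectedSquare ↔
      (¬ latticeDistSq z (1 - p.1) (0 - p.2) < 1 ∧ ¬ latticeDistSq z (-1 - p.1) (0 - p.2) < 1) ∧
      (¬ latticeDistSq z (0 - p.1) (1 - p.2) < 1 ∧ ¬ latticeDistSq z (0 - p.1) (-1 - p.2) < 1) := by
  have hu := ne_zero_of_mem hz p
  have hz3 := (mem_dissectedSquare_iff.1 hz).2.2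
  have h1 : branch p z ∈ dissectedSquare ↔
      (|(branch p z).re| < 1 / 2 ∧ |(branch p z).im| < 1 / 2) :=
    ⟨fun h => ⟨(mem_dissectedSquare_iff.1 h).1, (mem_dissectedSquare_iff.1 h).2.1⟩, branch_mem hz⟩
  rw [h1, branch, inv_mem_square_iff hu,
    ← two_mul_lt_normSq_iff p 1 0 (by simp) (hz3 _ _),
    ← two_mul_lt_normSq_iff p (-1) 0 (by simp) (hz3 _ _),
    ← two_mul_lt_normSq_iff p 0 1 (by simp) (hz3 _ _),
    ← two_mul_lt_normSq_iff p 0 (-1) (by simp) (hz3 _ _)]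
  simp [neg_mul, mul_add, add_comm]

lemma SameCell.branch_mem {z z' : ℂ} (hz : z ∈ dissectedSquare) (hz' : z' ∈ dissectedSquare)
    (h : SameCell z z') (p : ℤ × ℤ) (hp : branch p z ∈ dissectedSquare) :
    branch p z' ∈ dissectedSquare := by
  rw [branch_mem_iff hz] at hp
  rw [branch_mem_iff hz', ← h, ← h, ← h, ← h]
  exact hp

/-- The discs about `±1`, `±i` pull back to half planes, decided by the digit; the discs about `±1 ±
i` pull back to discs about Gaussian integers, decided by the cell of `z`. -/
lemma SameCell.branch_lt {z z' : ℂ} (hz : z ∈ dissectedSquare) (hz' : z' ∈ dissectedSquare)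
    (h : SameCell z z') (p : ℤ × ℤ) (hp : branch p z ∈ dissectedSquare) (m n : ℤ)
    (hmn : latticeDistSq (branch p z) m n < 1) : latticeDistSq (branch p z') m n < 1 := by
  obtain ⟨hw1, hw2, -⟩ := mem_dissectedSquare_iff.1 hp
  obtain ⟨hw1', hw2', -⟩ := mem_dissectedSquare_iff.1 (h.branch_mem hz hz' p hp)
  obtain ⟨⟨hm1, hm2⟩, hn1, hn2⟩ := latticeDistSq_le_one hw1 hw2 hmn.le
  have hu := ne_zero_of_mem hz p
  have hu' := ne_zero_of_mem hz' p
  obtain ⟨hz1, hz2, hz3⟩ := mem_dissectedSquare_iff.1 hz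
  obtain ⟨hz1', hz2', hz3'⟩ := mem_dissectedSquare_iff.1 hz'
  by_cases h0 : m = 0 ∧ n = 0
  · obtain ⟨rfl, rfl⟩ := h0
    rw [abs_lt] at hw1' hw2'
    unfold latticeDistSq
    push_cast
    nlinarith
  rw [branch, inv_latticeDistSq_lt hu, normSq_latticePoint_add] at hmn
  rw [branch, inv_latticeDistSq_lt hu', normSq_latticePoint_add]
  simp only [add_re, add_im, latticePoint_re, latticePoint_im] at hmn ⊢
  have e1 := one_lt_two_mul_of_abs_lt hz1 hz1' p.1 1 (by simp)
  have e2 := one_lt_two_mul_of_abs_lt hz1 hz1' p.1 (-1) (by simp)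
  have e3 := one_lt_two_mul_of_abs_lt hz2 hz2' p.2 1 (by simp)
  have e4 := one_lt_two_mul_of_abs_lt hz2 hz2' p.2 (-1) (by simp)
  have e5 := (h (m - p.1) (-n - p.2)).1
  unfold latticeDistSq at e5
  push_cast at e1 e2 e3 e4 e5
  interval_cases m <;> interval_cases n <;> push_cast at hmn e5 ⊢ <;>
    first
    | exact absurd ⟨rfl, rfl⟩ h0
    | linarith [e1 (by linarith)]
    | linarith [e2 (by linarith)]
    | linarith [e3 (by linarith)]
    | linarith [e4 (by linarith)]
    | linarith [e5 (by linarith)]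

lemma SameCell.branch {z z' : ℂ} (hz : z ∈ dissectedSquare) (hz' : z' ∈ dissectedSquare)
    (h : SameCell z z') (p : ℤ × ℤ) (hp : branch p z ∈ dissectedSquare) :
    SameCell (branch p z) (branch p z') := fun m n =>
  ⟨h.branch_lt hz hz' p hp m n,
    h.symm.branch_lt hz' hz p (h.branch_mem hz hz' p hp) m n⟩

/-! ### Every cell contains the image of the square under a composition of two branches -/

/-- A cell is encoded by the Gaussian integers at distance less than 1: three for a wedge at the
origin, two for a sliver along a half axis, four for a corner. This and the next two lemmas recover
the full list from a few inequalities. -/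
lemma latticeDistSq_lt_iff_of_wedge {w : ℂ} (hw : w ∈ dissectedSquare) {s t : ℤ}
    (hs : s = 1 ∨ s = -1) (ht : t = 1 ∨ t = -1) (h1 : latticeDistSq w s 0 < 1)
    (h2 : latticeDistSq w 0 t < 1) (h3 : ¬ latticeDistSq w s t < 1) (m n : ℤ) :
    latticeDistSq w m n < 1 ↔ (m = 0 ∧ n = 0) ∨ (m = s ∧ n = 0) ∨ (m = 0 ∧ n = t) := by
  obtain ⟨hx, hy, -⟩ := mem_dissectedSquare_iff.1 hw
  constructor
  · intro h
    obtain ⟨⟨hm1, hm2⟩, hn1, hn2⟩ := latticeDistSq_le_one hx hy h.le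
    rw [abs_lt] at hx hy
    unfold latticeDistSq at *
    rcases hs with rfl | rfl <;> rcases ht with rfl | rfl <;> interval_cases m <;>
      interval_cases n <;> push_cast at * <;> first | simp; done | (exfalso; nlinarith)
  · rw [abs_lt] at hx hy
    rintro (⟨rfl, rfl⟩ | ⟨rfl, rfl⟩ | ⟨rfl, rfl⟩)
    · unfold latticeDistSq; push_cast; nlinarith
    · exact h1
    · exact h2

lemma latticeDistSq_lt_iff_of_sliver {w : ℂ} (hw : w ∈ dissectedSquare) {s t : ℤ}
    (hst : (s = 1 ∧ t = 0) ∨ (s = -1 ∧ t = 0) ∨ (s = 0 ∧ t = 1) ∨ (s = 0 ∧ t = -1))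
    (h1 : latticeDistSq w s t < 1) (h2 : ¬ latticeDistSq w t s < 1)
    (h3 : ¬ latticeDistSq w (-t) (-s) < 1) (m n : ℤ) :
    latticeDistSq w m n < 1 ↔ (m = 0 ∧ n = 0) ∨ (m = s ∧ n = t) := by
  obtain ⟨hx, hy, -⟩ := mem_dissectedSquare_iff.1 hw
  constructor
  · intro h
    obtain ⟨⟨hm1, hm2⟩, hn1, hn2⟩ := latticeDistSq_le_one hx hy h.le
    rw [abs_lt] at hx hy
    unfold latticeDistSq at *
    rcases hst with ⟨rfl, rfl⟩ | ⟨rfl, rfl⟩ | ⟨rfl, rfl⟩ | ⟨rfl, rfl⟩ <;> interval_cases m <;>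
      interval_cases n <;> push_cast at * <;> first | simp; done | (exfalso; nlinarith)
  · rw [abs_lt] at hx hy
    rintro (⟨rfl, rfl⟩ | ⟨rfl, rfl⟩)
    · unfold latticeDistSq; push_cast; nlinarith
    · exact h1

lemma latticeDistSq_lt_iff_of_corner {w : ℂ} (hw : w ∈ dissectedSquare) {s t : ℤ}
    (hs : s = 1 ∨ s = -1) (ht : t = 1 ∨ t = -1) (h1 : latticeDistSq w s t < 1) (m n : ℤ) :
    latticeDistSq w m n < 1 ↔ (m = 0 ∨ m = s) ∧ (n = 0 ∨ n = t) := by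
  obtain ⟨hx, hy, -⟩ := mem_dissectedSquare_iff.1 hw
  constructor
  · intro h
    obtain ⟨⟨hm1, hm2⟩, hn1, hn2⟩ := latticeDistSq_le_one hx hy h.le
    rw [abs_lt] at hx hy
    unfold latticeDistSq at *
    rcases hs with rfl | rfl <;> rcases ht with rfl | rfl <;> interval_cases m <;>
      interval_cases n <;> push_cast at * <;> first | simp; done | (exfalso; nlinarith)
  · rw [abs_lt] at hx hy
    unfold latticeDistSq at *
    rcases hs with rfl | rfl <;> rcases ht with rfl | rfl <;>
      rintro ⟨rfl | rfl, rfl | rfl⟩ <;> push_cast at * <;> nlinarith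

lemma cell_cases {w : ℂ} (hw : w ∈ dissectedSquare) :
    (∃ s t : ℤ, (s = 1 ∨ s = -1) ∧ (t = 1 ∨ t = -1) ∧ latticeDistSq w s t < 1) ∨
    (∃ s t : ℤ, (s = 1 ∨ s = -1) ∧ (t = 1 ∨ t = -1) ∧ latticeDistSq w s 0 < 1 ∧
      latticeDistSq w 0 t < 1 ∧ ¬ latticeDistSq w s t < 1) ∨
    (∃ s t : ℤ, ((s = 1 ∧ t = 0) ∨ (s = -1 ∧ t = 0) ∨ (s = 0 ∧ t = 1) ∨ (s = 0 ∧ t = -1)) ∧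
      latticeDistSq w s t < 1 ∧ ¬ latticeDistSq w t s < 1 ∧ ¬ latticeDistSq w (-t) (-s) < 1) := by
  by_cases hc : ∃ s t : ℤ, (s = 1 ∨ s = -1) ∧ (t = 1 ∨ t = -1) ∧ latticeDistSq w s t < 1
  · exact Or.inl hc
  refine Or.inr ?_
  by_cases hA : ∃ s t : ℤ, (s = 1 ∨ s = -1) ∧ (t = 1 ∨ t = -1) ∧ latticeDistSq w s 0 < 1 ∧
      latticeDistSq w 0 t < 1
  · obtain ⟨s, t, hs, ht, h1, h2⟩ := hA
    exact Or.inl ⟨s, t, hs, ht, h1, h2, fun h => hc ⟨s, t, hs, ht, h⟩⟩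
  refine Or.inr ?_
  by_cases hx : ∃ s : ℤ, (s = 1 ∨ s = -1) ∧ latticeDistSq w s 0 < 1
  · obtain ⟨s, hs, h⟩ := hx
    refine ⟨s, 0, by tauto, h, fun h' => hA ⟨s, s, hs, hs, h, h'⟩, fun h' =>
      hA ⟨s, -s, hs, by omega, h, by simpa using h'⟩⟩
  by_cases hy : ∃ t : ℤ, (t = 1 ∨ t = -1) ∧ latticeDistSq w 0 t < 1
  · obtain ⟨t, ht, h⟩ := hy
    exact ⟨0, t, by tauto, h, fun h' => hx ⟨t, ht, h'⟩, fun h' => hx ⟨-t, by omega, by simpa using h'⟩⟩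
  -- Outside the four discs about `±1`, `±i` both `2|x|` and `2|y|` are at most `x² + y²`. In the
  -- square this leaves only the origin, which lies on the circle about 1.
  exfalso
  obtain ⟨h1, h2, h3⟩ := mem_dissectedSquare_iff.1 hw
  rw [abs_lt] at h1 h2
  have a1 := fun h => hx ⟨1, by simp, h⟩
  have a2 := fun h => hx ⟨-1, by simp, h⟩
  have a3 := fun h => hy ⟨1, by simp, h⟩
  have a4 := fun h => hy ⟨-1, by simp, h⟩
  have h4 := h3 1 0
  unfold latticeDistSq at *
  push_cast at *
  have b1 := not_lt.1 a1
  have b2 := not_lt.1 a2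
  have b3 := not_lt.1 a3
  have b4 := not_lt.1 a4
  have hx0 : w.re ^ 2 + w.im ^ 2 ≤ 0 := by
    rcases le_total 0 w.re with c1 | c1 <;> rcases le_total 0 w.im with c2 | c2 <;> nlinarith
  have : w.re = 0 := by nlinarith [sq_nonneg w.re, sq_nonneg w.im]
  have : w.im = 0 := by nlinarith [sq_nonneg w.re, sq_nonneg w.im]
  simp_all

/-- The circles that obstruct such a digit are centred too far away to meet the square. -/
lemma branch_mem_of_three_le {z : ℂ} (hz : z ∈ dissectedSquare) {p : ℤ × ℤ}
    (hp : 3 ≤ |p.1| ∨ 3 ≤ |p.2|) : branch p z ∈ dissectedSquare := by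
  obtain ⟨h1, h2, -⟩ := mem_dissectedSquare_iff.1 hz
  rw [le_abs, le_abs] at hp
  rw [branch_mem_iff hz]
  refine ⟨⟨?_, ?_⟩, ?_, ?_⟩ <;> intro h <;> have := latticeDistSq_le_one h1 h2 h.le <;> omega

lemma branch_latticeDistSq_lt {z : ℂ} (hz : z ∈ dissectedSquare) (p : ℤ × ℤ) (m n : ℤ) :
    latticeDistSq (branch p z) m n < 1 ↔
      1 - 2 * m * (p.1 + z.re) + 2 * n * (p.2 + z.im) +
        ((m : ℝ) ^ 2 + (n : ℝ) ^ 2 - 1) * ((p.1 + z.re) ^ 2 + (p.2 + z.im) ^ 2) < 0 := by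
  rw [branch, inv_latticeDistSq_lt (ne_zero_of_mem hz p), normSq_latticePoint_add]
  simp

lemma exists_two_branches {w : ℂ} (hw : w ∈ dissectedSquare) :
    ∃ p q : ℤ × ℤ, (|p.1| ≤ 3 ∧ |p.2| ≤ 3) ∧ (|q.1| ≤ 3 ∧ |q.2| ≤ 3) ∧ ∀ z ∈ dissectedSquare,
      branch q z ∈ dissectedSquare ∧ branch p (branch q z) ∈ dissectedSquare ∧
        SameCell w (branch p (branch q z)) := by
  rcases cell_cases hw with ⟨s, t, hs, ht, h⟩ | ⟨s, t, hs, ht, h1, h2, h3⟩ |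
    ⟨s, t, hst, h1, h2, h3⟩
  -- Corner points have reciprocals near `s - ti`, a digit that is not admissible everywhere. The
  -- first branch, with digit `3s + 3ti`, moves the square into the quadrant of `s - ti`, near `(s -
  -- ti) / 6`, where that digit is allowed.
  · refine ⟨(s, -t), (3 * s, 3 * t), ?_, ?_, fun z hz => ?_⟩
    · rcases hs with rfl | rfl <;> rcases ht with rfl | rfl <;> decide
    · rcases hs with rfl | rfl <;> rcases ht with rfl | rfl <;> decide
    have hq : branch (3 * s, 3 * t) z ∈ dissectedSquare :=
      branch_mem_of_three_le hz (Or.inl (by rcases hs with rfl | rfl <;> norm_num))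
    obtain ⟨hx, hy, -⟩ := mem_dissectedSquare_iff.1 hz
    obtain ⟨hx', hy', -⟩ := mem_dissectedSquare_iff.1 hq
    have g1 : latticeDistSq (branch (3 * s, 3 * t) z) s 0 < 1 := by
      rw [branch_latticeDistSq_lt hz]
      rw [abs_lt] at hx hy
      rcases hs with rfl | rfl <;> push_cast <;> linarith
    have g2 : latticeDistSq (branch (3 * s, 3 * t) z) 0 (-t) < 1 := by
      rw [branch_latticeDistSq_lt hz]
      rw [abs_lt] at hx hy
      rcases ht with rfl | rfl <;> push_cast <;> linarith
    set v := branch (3 * s, 3 * t) z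
    have hp : branch (s, -t) v ∈ dissectedSquare := by
      rw [branch_mem_iff hq]
      rw [abs_lt] at hx' hy'
      unfold latticeDistSq at *
      rcases hs with rfl | rfl <;> rcases ht with rfl | rfl <;> push_cast at * <;>
        refine ⟨⟨?_, ?_⟩, ?_, ?_⟩ <;> nlinarith
    refine ⟨hq, hp, ?_⟩
    have g3 : latticeDistSq (branch (s, -t) v) s t < 1 := by
      rw [branch_latticeDistSq_lt hq]
      rw [abs_lt] at hx' hy'
      rcases hs with rfl | rfl <;> rcases ht with rfl | rfl <;> push_cast at * <;> nlinarith
    intro m n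
    rw [latticeDistSq_lt_iff_of_corner hw hs ht h, latticeDistSq_lt_iff_of_corner hp hs ht g3]
  -- Here the outer digit `3s - 3ti` alone sends the whole square into the cell; the digit 3 only
  -- pads the composition to length two. The same choice serves the slivers below.
  · refine ⟨(3 * s, -3 * t), (3, 0), ?_, by decide, fun z hz => ?_⟩
    · rcases hs with rfl | rfl <;> rcases ht with rfl | rfl <;> decide
    have hq : branch (3, 0) z ∈ dissectedSquare := branch_mem_of_three_le hz (by simp)
    have hp : branch (3 * s, -3 * t) (branch (3, 0) z) ∈ dissectedSquare :=
      branch_mem_of_three_le hq (Or.inl (by rcases hs with rfl | rfl <;> norm_num))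
    refine ⟨hq, hp, ?_⟩
    obtain ⟨hx, hy, -⟩ := mem_dissectedSquare_iff.1 hq
    rw [abs_lt] at hx hy
    intro m n
    rw [latticeDistSq_lt_iff_of_wedge hw hs ht h1 h2 h3,
      latticeDistSq_lt_iff_of_wedge hp hs ht]
    · rw [branch_latticeDistSq_lt hq]
      rcases hs with rfl | rfl <;> push_cast <;> linarith
    · rw [branch_latticeDistSq_lt hq]
      rcases ht with rfl | rfl <;> push_cast <;> linarith
    · rw [branch_latticeDistSq_lt hq]
      rcases hs with rfl | rfl <;> rcases ht with rfl | rfl <;> push_cast <;> nlinarith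
  · refine ⟨(3 * s, -3 * t), (3, 0), ?_, by decide, fun z hz => ?_⟩
    · rcases hst with ⟨rfl, rfl⟩ | ⟨rfl, rfl⟩ | ⟨rfl, rfl⟩ | ⟨rfl, rfl⟩ <;> decide
    have hq : branch (3, 0) z ∈ dissectedSquare := branch_mem_of_three_le hz (by simp)
    have hp : branch (3 * s, -3 * t) (branch (3, 0) z) ∈ dissectedSquare :=
      branch_mem_of_three_le hq
        (by rcases hst with ⟨rfl, rfl⟩ | ⟨rfl, rfl⟩ | ⟨rfl, rfl⟩ | ⟨rfl, rfl⟩ <;> decide)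
    refine ⟨hq, hp, ?_⟩
    obtain ⟨hx, hy, -⟩ := mem_dissectedSquare_iff.1 hq
    rw [abs_lt] at hx hy
    intro m n
    rw [latticeDistSq_lt_iff_of_sliver hw hst h1 h2 h3,
      latticeDistSq_lt_iff_of_sliver hp hst] <;> rw [branch_latticeDistSq_lt hq] <;>
    rcases hst with ⟨rfl, rfl⟩ | ⟨rfl, rfl⟩ | ⟨rfl, rfl⟩ | ⟨rfl, rfl⟩ <;> push_cast <;> linarith

/-! ### The transfer operator and distortion -/

open scoped ENNReal NNReal Function

lemma sq_norm_le_half {w : ℂ} (hw : w ∈ dissectedSquare) : ‖w‖ ^ 2 ≤ 1 / 2 := by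
  obtain ⟨h1, h2, -⟩ := mem_dissectedSquare_iff.1 hw
  rw [norm_sq_eq]
  have := sq_lt_sq' (abs_lt.1 h1).1 (abs_lt.1 h1).2
  have := sq_lt_sq' (abs_lt.1 h2).1 (abs_lt.1 h2).2
  linarith

lemma norm_le_one_of_mem {w : ℂ} (hw : w ∈ dissectedSquare) : ‖w‖ ≤ 1 := by
  nlinarith [sq_norm_le_half hw, norm_nonneg w]

lemma norm_sub_le_two {w w' : ℂ} (hw : w ∈ dissectedSquare) (hw' : w' ∈ dissectedSquare) :
    ‖w - w'‖ ≤ 2 := by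
  linarith [norm_sub_le w w', norm_le_one_of_mem hw, norm_le_one_of_mem hw']

lemma norm_branch_sub {z z' : ℂ} (hz : z ∈ dissectedSquare) (hz' : z' ∈ dissectedSquare)
    (p : ℤ × ℤ) : ‖branch p z - branch p z'‖ = ‖z - z'‖ * (‖branch p z‖ * ‖branch p z'‖) := by
  have hu := ne_zero_of_mem hz p
  have hu' := ne_zero_of_mem hz' p
  rw [branch, branch, ← norm_mul, ← norm_mul, ← norm_neg]
  congr 1
  field_simp
  ring

lemma norm_branch_sub_le {z z' : ℂ} (hz : z ∈ dissectedSquare) (hz' : z' ∈ dissectedSquare)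
    {p : ℤ × ℤ} (hp : branch p z ∈ dissectedSquare) (hp' : branch p z' ∈ dissectedSquare) :
    ‖branch p z - branch p z'‖ ≤ ‖z - z'‖ / 2 := by
  rw [norm_branch_sub hz hz']
  have h1 := sq_norm_le_half hp
  have h2 := sq_norm_le_half hp'
  have : ‖branch p z‖ * ‖branch p z'‖ ≤ 1 / 2 := by
    nlinarith [sq_nonneg (‖branch p z‖ - ‖branch p z'‖)]
  nlinarith [norm_nonneg (z - z')]

/-- With `u = p + z` and `u' = p + z'`, admissibility gives `|u| ≥ 1`, hence `|u'| ≤ (1 + |z - z'|)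
|u|`. -/
lemma norm_branch_le_exp {z z' : ℂ} (hz : z ∈ dissectedSquare) (hz' : z' ∈ dissectedSquare)
    {p : ℤ × ℤ} (hp : branch p z ∈ dissectedSquare) :
    ‖branch p z‖ ≤ Real.exp ‖z - z'‖ * ‖branch p z'‖ := by
  have hu := norm_pos_iff.2 (ne_zero_of_mem hz p)
  have hu' := norm_pos_iff.2 (ne_zero_of_mem hz' p)
  have h1 : ‖branch p z‖ ≤ 1 := norm_le_one_of_mem hp
  unfold branch at *
  rw [norm_inv] at *
  have h2 : 1 ≤ ‖latticePoint p + z‖ := (inv_le_one₀ hu).1 h1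
  have h3 : ‖latticePoint p + z'‖ ≤ ‖latticePoint p + z‖ + ‖z - z'‖ := by
    have := norm_sub_le (latticePoint p + z) (z - z')
    rwa [show latticePoint p + z - (z - z') = latticePoint p + z' by ring] at this
  have h4 : ‖latticePoint p + z'‖ ≤ Real.exp ‖z - z'‖ * ‖latticePoint p + z‖ := by
    have := Real.add_one_le_exp ‖z - z'‖
    nlinarith [norm_nonneg (z - z')]
  rw [norm_inv, inv_eq_one_div, inv_eq_one_div, mul_one_div, div_le_div_iff₀ hu hu']
  linarith

/-- The Perron-Frobenius operator of the Hurwitz map with respect to Lebesgue measure on the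
dissected square. -/
noncomputable def transfer (f : ℂ → ℝ≥0∞) (z : ℂ) : ℝ≥0∞ :=
  ∑' p : ℤ × ℤ, ‖branch p z‖ₑ ^ 4 * dissectedSquare.indicator f (branch p z)

/-- `f` is log-Lipschitz with constant `K` on each cell of the dissected square. -/
def LogLipschitz (K : ℝ) (f : ℂ → ℝ≥0∞) : Prop :=
  ∀ z ∈ dissectedSquare, ∀ z' ∈ dissectedSquare, SameCell z z' →
    f z ≤ ENNReal.ofReal (Real.exp (K * ‖z - z'‖)) * f z'

lemma ofReal_exp_mul (a b : ℝ) : ENNReal.ofReal (Real.exp a) * ENNReal.ofReal (Real.exp b) =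
    ENNReal.ofReal (Real.exp (a + b)) := by
  rw [Real.exp_add, ENNReal.ofReal_mul (Real.exp_pos a).le]

lemma LogLipschitz.mono {K K' : ℝ} {f : ℂ → ℝ≥0∞} (hf : LogLipschitz K f) (h : K ≤ K') :
    LogLipschitz K' f := by
  intro z hz z' hz' hc
  refine (hf z hz z' hz' hc).trans ?_
  gcongr

/-- The term `K / 2` is the contraction of the branches, the 4 is the distortion of the Jacobian `|1
/ (p + z)| ^ 4`. The sums at `z` and `z'` run over the same digits because the points share a cell.
-/
lemma LogLipschitz.transfer {K : ℝ} {f : ℂ → ℝ≥0∞} (hK : 0 ≤ K) (hf : LogLipschitz K f) :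
    LogLipschitz (K / 2 + 4) (transfer f) := by
  intro z hz z' hz' hc
  unfold _root_.transfer
  rw [← ENNReal.tsum_mul_left]
  refine ENNReal.tsum_le_tsum fun p => ?_
  by_cases hp : branch p z ∈ dissectedSquare
  · have hp' := hc.branch_mem hz hz' p hp
    rw [Set.indicator_of_mem hp, Set.indicator_of_mem hp']
    have h1 : ‖branch p z‖ₑ ≤ ENNReal.ofReal (Real.exp ‖z - z'‖) * ‖branch p z'‖ₑ := by
      rw [← ofReal_norm, ← ofReal_norm, ← ENNReal.ofReal_mul (Real.exp_pos _).le]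
      exact ENNReal.ofReal_le_ofReal (norm_branch_le_exp hz hz' hp)
    have h2 : f (branch p z) ≤
        ENNReal.ofReal (Real.exp (K / 2 * ‖z - z'‖)) * f (branch p z') := by
      refine (hf _ hp _ hp' (hc.branch hz hz' p hp)).trans ?_
      have := norm_branch_sub_le hz hz' hp hp'
      gcongr ?_ * _
      refine ENNReal.ofReal_le_ofReal (Real.exp_le_exp.2 ?_)
      nlinarith
    calc ‖branch p z‖ₑ ^ 4 * f (branch p z)
        ≤ (ENNReal.ofReal (Real.exp ‖z - z'‖) * ‖branch p z'‖ₑ) ^ 4 *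
          (ENNReal.ofReal (Real.exp (K / 2 * ‖z - z'‖)) * f (branch p z')) := by gcongr
      _ = (ENNReal.ofReal (Real.exp ‖z - z'‖) ^ 4 * ENNReal.ofReal (Real.exp (K / 2 * ‖z - z'‖))) *
          (‖branch p z'‖ₑ ^ 4 * f (branch p z')) := by ring
      _ = _ := by
        rw [← ENNReal.ofReal_pow (Real.exp_pos _).le, ← Real.exp_nat_mul, ofReal_exp_mul]
        congr 4
        push_cast
        ring
  · simp [Set.indicator_of_notMem hp]

lemma le_transfer (f : ℂ → ℝ≥0∞) {z : ℂ} {p : ℤ × ℤ} (hp : branch p z ∈ dissectedSquare) :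
    ‖branch p z‖ₑ ^ 4 * f (branch p z) ≤ transfer f z := by
  refine le_of_eq_of_le ?_ (ENNReal.le_tsum p)
  rw [Set.indicator_of_mem hp]

lemma enorm_branch_ge {z : ℂ} (hz : z ∈ dissectedSquare) {p : ℤ × ℤ} (h1 : |p.1| ≤ 3)
    (h2 : |p.2| ≤ 3) : (8 : ℝ≥0∞)⁻¹ ≤ ‖branch p z‖ₑ := by
  have hu := ne_zero_of_mem hz p
  rw [branch, enorm_inv hu, ENNReal.inv_le_inv]
  have h3 : ‖latticePoint p + z‖ ≤ 8 := by
    refine (norm_add_le _ _).trans ?_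
    have h4 : ‖latticePoint p‖ ≤ |(p.1 : ℝ)| + |(p.2 : ℝ)| := by
      simpa using norm_le_abs_re_add_abs_im (latticePoint p)
    have h5 : |(p.1 : ℝ)| ≤ 3 := by exact_mod_cast h1
    have h6 : |(p.2 : ℝ)| ≤ 3 := by exact_mod_cast h2
    linarith [norm_le_one_of_mem hz]
  rw [← ofReal_norm]
  simpa using ENNReal.ofReal_le_ofReal h3

/-- The constant of the lower bound for the second iterate of the transfer operator. -/
noncomputable def minorant : ℝ≥0∞ := (8 : ℝ≥0∞)⁻¹ ^ 8 * ENNReal.ofReal (Real.exp (-48))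

lemma minorant_pos : 0 < minorant := by
  unfold minorant
  refine ENNReal.mul_pos ?_ ?_
  · simp
  · simp [Real.exp_pos]

lemma minorant_le_one : minorant ≤ 1 := by
  unfold minorant
  refine mul_le_one' (pow_le_one' (ENNReal.inv_le_one.2 (by norm_num)) _) ?_
  rw [ENNReal.ofReal_le_one, Real.exp_le_one_iff]
  norm_num

/-- Of the double sum keep one term, whose argument lies in the cell of `w`. Each of its two
Jacobians is at least `8⁻¹ ^ 4`; comparing `f` there with `f w` costs `exp (-48)`, since the
constant is 24 and distances are at most 2. -/
lemma LogLipschitz.minorant_mul_le {f : ℂ → ℝ≥0∞} (hf : LogLipschitz 24 f) {z w : ℂ}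
    (hz : z ∈ dissectedSquare) (hw : w ∈ dissectedSquare) :
    minorant * f w ≤ _root_.transfer (_root_.transfer f) z := by
  obtain ⟨p, q, ⟨hp1, hp2⟩, ⟨hq1, hq2⟩, h⟩ := exists_two_branches hw
  obtain ⟨hq, hp, hc⟩ := h z hz
  have h1 := hf w hw _ hp hc
  have h2 : ENNReal.ofReal (Real.exp (-48)) * f w ≤ f (branch p (branch q z)) := by
    calc ENNReal.ofReal (Real.exp (-48)) * f w
        ≤ ENNReal.ofReal (Real.exp (-48)) * (ENNReal.ofReal (Real.exp 48) *
            f (branch p (branch q z))) := by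
          gcongr
          refine h1.trans ?_
          gcongr
          linarith [norm_sub_le_two hw hp]
      _ = f (branch p (branch q z)) := by
          rw [← mul_assoc, ofReal_exp_mul]
          simp
  calc minorant * f w
      = (8 : ℝ≥0∞)⁻¹ ^ 4 * ((8 : ℝ≥0∞)⁻¹ ^ 4 * (ENNReal.ofReal (Real.exp (-48)) * f w)) := by
        unfold minorant; ring
    _ ≤ ‖branch q z‖ₑ ^ 4 * (‖branch p (branch q z)‖ₑ ^ 4 * f (branch p (branch q z))) := by
        gcongr
        · exact enorm_branch_ge hz hq1 hq2
        · exact enorm_branch_ge hq hp1 hp2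
    _ ≤ ‖branch q z‖ₑ ^ 4 * _root_.transfer f (branch q z) := by
        gcongr
        exact le_transfer f hp
    _ ≤ _ := le_transfer _ hq

lemma transfer_congr {f g : ℂ → ℝ≥0∞} (h : Set.EqOn f g dissectedSquare) :
    transfer f = transfer g := by
  ext z
  unfold transfer
  rw [Set.indicator_congr h]

lemma transfer_add (f g : ℂ → ℝ≥0∞) : transfer (f + g) = transfer f + transfer g := by
  ext z
  simp only [transfer, Pi.add_apply, Set.indicator_add', mul_add]
  rw [ENNReal.tsum_add]

lemma transfer_const_mul (c : ℝ≥0∞) (f : ℂ → ℝ≥0∞) :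
    transfer (fun z => c * f z) = fun z => c * transfer f z := by
  ext z
  unfold transfer
  rw [← ENNReal.tsum_mul_left]
  refine tsum_congr fun p => ?_
  rw [Set.indicator_const_mul]
  ring

lemma transfer_iterate_add (f g : ℂ → ℝ≥0∞) (n : ℕ) :
    transfer^[n] (f + g) = transfer^[n] f + transfer^[n] g := by
  induction n generalizing f g with
  | zero => rfl
  | succ n ih => rw [Function.iterate_succ_apply, transfer_add, ih]; rfl

lemma transfer_iterate_const_mul (c : ℝ≥0∞) (f : ℂ → ℝ≥0∞) (n : ℕ) :
    transfer^[n] (fun z => c * f z) = fun z => c * transfer^[n] f z := by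
  induction n generalizing f with
  | zero => rfl
  | succ n ih => rw [Function.iterate_succ_apply, transfer_const_mul, ih]; rfl

lemma LogLipschitz.iterate {f : ℂ → ℝ≥0∞} (hf : LogLipschitz 24 f) (n : ℕ) :
    LogLipschitz 24 (_root_.transfer^[n] f) := by
  induction n generalizing f with
  | zero => exact hf
  | succ n ih => exact ih ((hf.transfer (by norm_num)).mono (by norm_num))

/-! ### Null sets and duality -/

/-- The half-integer grid lines together with the unit circles about the Gaussian integers. -/
def exceptionalSet : Set ℂ :=
  {u | (∃ n : ℤ, u.re = n + 1 / 2) ∨ (∃ n : ℤ, u.im = n + 1 / 2) ∨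
    ∃ m n : ℤ, latticeDistSq u m n = 1}

lemma volume_re_eq (c : ℝ) : volume {z : ℂ | z.re = c} = 0 := by
  have h : {z : ℂ | z.re = c} = measurableEquivRealProd ⁻¹' ({c} ×ˢ Set.univ) := by
    ext z; simp
  rw [h, volume_preserving_equiv_real_prod.measure_preimage_equiv, Measure.volume_eq_prod,
    Measure.prod_prod]
  simp

lemma volume_im_eq (c : ℝ) : volume {z : ℂ | z.im = c} = 0 := by
  have h : {z : ℂ | z.im = c} = measurableEquivRealProd ⁻¹' (Set.univ ×ˢ {c}) := by
    ext z; simp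
  rw [h, volume_preserving_equiv_real_prod.measure_preimage_equiv, Measure.volume_eq_prod,
    Measure.prod_prod]
  simp

lemma volume_latticeDistSq_eq_one (m n : ℤ) : volume {z : ℂ | latticeDistSq z m n = 1} = 0 := by
  have h : {z : ℂ | latticeDistSq z m n = 1} = Metric.sphere (latticePoint (m, n)) 1 := by
    ext z
    simp [latticeDistSq, norm_eq_one_iff_sq]
  rw [h, Measure.addHaar_sphere]

lemma volume_exceptionalSet : volume exceptionalSet = 0 := by
  have h : exceptionalSet = (⋃ n : ℤ, {u : ℂ | u.re = n + 1 / 2}) ∪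
      ((⋃ n : ℤ, {u : ℂ | u.im = n + 1 / 2}) ∪ ⋃ m : ℤ, ⋃ n : ℤ, {u : ℂ | latticeDistSq u m n = 1}) := by
    ext u; simp [exceptionalSet]
  rw [h]
  simp only [measure_union_null_iff, measure_iUnion_null_iff]
  exact ⟨fun n => volume_re_eq _, fun n => volume_im_eq _,
    fun m n => volume_latticeDistSq_eq_one m n⟩

lemma measurableSet_dissectedSquare : MeasurableSet dissectedSquare := by
  have h : dissectedSquare = {z : ℂ | |z.re| < 1 / 2} ∩ ({z : ℂ | |z.im| < 1 / 2} ∩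
      ⋂ m : ℤ, ⋂ n : ℤ, {z : ℂ | latticeDistSq z m n = 1}ᶜ) := by
    ext z; simp [mem_dissectedSquare_iff]
  rw [h]
  refine (measurableSet_lt (by fun_prop) (by fun_prop)).inter
    ((measurableSet_lt (by fun_prop) (by fun_prop)).inter
    (.iInter fun m => .iInter fun n => (measurableSet_eq_fun ?_ (by fun_prop)).compl))
  unfold latticeDistSq
  fun_prop

lemma measurable_hurwitzMap : Measurable hurwitzMap := by
  unfold hurwitzMap nearestGaussian
  have h : Measurable fun z : ℂ => 1 / z := measurable_const.div measurable_id
  refine h.sub (Measurable.add ?_ (Measurable.mul ?_ measurable_const))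
  · exact (measurable_from_top (f := fun n : ℤ => (n : ℂ))).comp
      (Int.measurable_ceil.comp ((measurable_re.comp h).sub_const _))
  · exact (measurable_from_top (f := fun n : ℤ => (n : ℂ))).comp
      (Int.measurable_ceil.comp ((measurable_im.comp h).sub_const _))

lemma measurable_branch (p : ℤ × ℤ) : Measurable (branch p) := by
  unfold branch
  fun_prop

lemma measurable_transfer {f : ℂ → ℝ≥0∞} (hf : Measurable f) : Measurable (transfer f) := by
  unfold transfer
  refine Measurable.tsum fun p => ?_
  exact ((measurable_branch p).enorm.pow_const 4).mul
    ((hf.indicator measurableSet_dissectedSquare).comp (measurable_branch p))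

lemma measurable_transfer_iterate {f : ℂ → ℝ≥0∞} (hf : Measurable f) (n : ℕ) :
    Measurable (transfer^[n] f) := by
  induction n generalizing f with
  | zero => exact hf
  | succ n ih => exact ih (measurable_transfer hf)

lemma dissectedSquare_subset : dissectedSquare ⊆ hurwitzSquare :=
  fun _ hz => interior_subset hz.1

lemma dissectedSquare_ae_eq : dissectedSquare =ᵐ[volume] hurwitzSquare := by
  refine dissectedSquare_subset.eventuallyLE.antisymm ?_
  rw [ae_le_set]
  refine measure_mono_null ?_ volume_exceptionalSet
  rintro z ⟨⟨⟨h1, h2⟩, h3, h4⟩, h5⟩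
  by_contra h
  simp only [exceptionalSet, Set.mem_ofPred_eq, not_or, not_exists] at h
  refine h5 (mem_dissectedSquare_iff.2 ⟨?_, ?_, h.2.2⟩)
  · have := h.1 (-1)
    push_cast at this
    exact abs_lt.2 ⟨lt_of_le_of_ne h1 fun h' => this (by linarith), h2⟩
  · have := h.2.1 (-1)
    push_cast at this
    exact abs_lt.2 ⟨lt_of_le_of_ne h3 fun h' => this (by linarith), h4⟩

lemma volume_hurwitzSquare : volume hurwitzSquare = 1 := by
  have h : hurwitzSquare = measurableEquivRealProd ⁻¹'
      (Set.Ico (-(1 / 2)) (1 / 2) ×ˢ Set.Ico (-(1 / 2)) (1 / 2)) := by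
    ext z; simp [hurwitzSquare]
  rw [h, volume_preserving_equiv_real_prod.measure_preimage_equiv, Measure.volume_eq_prod,
    Measure.prod_prod, Real.volume_Ico]
  norm_num

lemma volume_dissectedSquare : volume dissectedSquare = 1 := by
  rw [measure_congr dissectedSquare_ae_eq, volume_hurwitzSquare]

lemma nearestGaussian_add {z : ℂ} (h1 : |z.re| < 1 / 2) (h2 : |z.im| < 1 / 2) (p : ℤ × ℤ) :
    nearestGaussian (latticePoint p + z) = latticePoint p := by
  rw [abs_lt] at h1 h2
  have e1 : ⌈(latticePoint p + z).re - 1 / 2⌉ = p.1 := by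
    rw [Int.ceil_eq_iff]
    simp only [add_re, latticePoint_re]
    constructor <;> linarith
  have e2 : ⌈(latticePoint p + z).im - 1 / 2⌉ = p.2 := by
    rw [Int.ceil_eq_iff]
    simp only [add_im, latticePoint_im]
    constructor <;> linarith
  unfold nearestGaussian
  rw [e1, e2, latticePoint]

lemma hurwitzMap_branch {z : ℂ} (hz : z ∈ dissectedSquare) (p : ℤ × ℤ) :
    hurwitzMap (branch p z) = z := by
  obtain ⟨h1, h2, -⟩ := mem_dissectedSquare_iff.1 hz
  rw [hurwitzMap, branch, one_div, inv_inv, nearestGaussian_add h1 h2]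
  ring

/-- Off the exceptional set every complex number is a Gaussian integer plus a point of the
dissected square. -/
lemma exists_eq_add_of_notMem {u : ℂ} (hu : u ∉ exceptionalSet) :
    ∃ p : ℤ × ℤ, ∃ z ∈ dissectedSquare, u = latticePoint p + z := by
  simp only [exceptionalSet, Set.mem_ofPred_eq, not_or, not_exists] at hu
  obtain ⟨h1, h2, h3⟩ := hu
  refine ⟨(⌈u.re - 1 / 2⌉, ⌈u.im - 1 / 2⌉), u - latticePoint (⌈u.re - 1 / 2⌉, ⌈u.im - 1 / 2⌉),
    mem_dissectedSquare_iff.2 ⟨?_, ?_, fun m n h => ?_⟩, by ring⟩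
  · have e1 := Int.le_ceil (u.re - 1 / 2)
    have e2 := Int.ceil_lt_add_one (u.re - 1 / 2)
    have e3 := h1 ⌈u.re - 1 / 2⌉
    simp only [sub_re, latticePoint_re, abs_lt]
    exact ⟨by linarith, lt_of_le_of_ne (by linarith) fun h => e3 (by linarith)⟩
  · have e1 := Int.le_ceil (u.im - 1 / 2)
    have e2 := Int.ceil_lt_add_one (u.im - 1 / 2)
    have e3 := h2 ⌈u.im - 1 / 2⌉
    simp only [sub_im, latticePoint_im, abs_lt]
    exact ⟨by linarith, lt_of_le_of_ne (by linarith) fun h => e3 (by linarith)⟩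
  · refine h3 (m + ⌈u.re - 1 / 2⌉) (n + ⌈u.im - 1 / 2⌉) ?_
    refine Eq.trans ?_ h
    unfold latticeDistSq
    simp only [sub_re, sub_im, latticePoint_re, latticePoint_im]
    push_cast
    ring

lemma latticePoint_injective : Function.Injective latticePoint := fun p q h => by
  have h1 := congrArg re h
  have h2 := congrArg im h
  simp only [latticePoint_re, latticePoint_im, Int.cast_inj] at h1 h2
  exact Prod.ext h1 h2

/-- The part of the dissected square that the branch `p` maps into the dissected square. -/
def branchDomain (p : ℤ × ℤ) : Set ℂ := dissectedSquare ∩ branch p ⁻¹' dissectedSquare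

lemma measurableSet_branchDomain (p : ℤ × ℤ) : MeasurableSet (branchDomain p) :=
  measurableSet_dissectedSquare.inter (measurable_branch p measurableSet_dissectedSquare)

lemma injOn_branch (p : ℤ × ℤ) : Set.InjOn (branch p) (branchDomain p) := fun z hz z' hz' h => by
  rw [← hurwitzMap_branch hz.1 p, h, hurwitzMap_branch hz'.1 p]

lemma pairwise_disjoint_image_branch :
    Pairwise (Disjoint on fun p => branch p '' branchDomain p) := by
  intro p q hpq
  refine Set.disjoint_left.2 ?_
  rintro w ⟨z, hz, rfl⟩ ⟨z', hz', h⟩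
  have e : z' = z := by
    rw [← hurwitzMap_branch hz'.1 q, h, hurwitzMap_branch hz.1 p]
  subst e
  have := inv_injective h
  exact hpq (latticePoint_injective (add_right_cancel this)).symm

/-- The points missed are reciprocals of exceptional points, and inversion, being differentiable off
0, preserves null sets. -/
lemma iUnion_image_branch_ae_eq :
    (⋃ p, branch p '' branchDomain p) =ᵐ[volume] dissectedSquare := by
  have hsub : (⋃ p, branch p '' branchDomain p) ⊆ dissectedSquare := by
    refine Set.iUnion_subset fun p => ?_
    rintro _ ⟨z, hz, rfl⟩
    exact hz.2
  refine hsub.eventuallyLE.antisymm (ae_le_set.2 ?_)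
  have hnull : volume ((fun z : ℂ => z⁻¹) '' (exceptionalSet \ {0})) = 0 := by
    refine addHaar_image_eq_zero_of_differentiableOn_of_addHaar_eq_zero _ ?_
      (measure_mono_null Set.sdiff_subset volume_exceptionalSet)
    intro z hz
    exact ((differentiableAt_inv (𝕜 := ℂ) hz.2).restrictScalars ℝ).differentiableWithinAt
  refine measure_mono_null ?_ hnull
  rintro w ⟨hw, hn⟩
  have hw0 : w ≠ 0 := by
    rintro rfl
    exact (mem_dissectedSquare_iff.1 hw).2.2 1 0 (by simp [latticeDistSq])
  refine ⟨w⁻¹, ⟨?_, by simpa using hw0⟩, inv_inv w⟩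
  by_contra h
  obtain ⟨p, z, hz, hzp⟩ := exists_eq_add_of_notMem h
  have hb : branch p z = w := by rw [branch, ← hzp, inv_inv]
  exact hn (Set.mem_iUnion.2 ⟨p, z, ⟨hz, by rwa [Set.mem_preimage, hb]⟩, hb⟩)

lemma hasFDerivAt_branch {z : ℂ} {p : ℤ × ℤ} (hz : latticePoint p + z ≠ 0) :
    ∃ f' : ℂ →L[ℝ] ℂ, HasFDerivAt (branch p) f' z ∧ |f'.det| = ‖branch p z‖ ^ 4 := by
  have h : HasDerivAt (branch p) (-((latticePoint p + z) ^ 2)⁻¹) z := by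
    have h1 : HasDerivAt (fun z => latticePoint p + z) 1 z := (hasDerivAt_id z).const_add _
    have h2 := (hasDerivAt_inv hz).comp z h1
    rw [mul_one] at h2
    exact h2
  refine ⟨_, h.hasFDerivAt.restrictScalars ℝ, ?_⟩
  simp [ContinuousLinearMap.det, LinearMap.det_restrictScalars, Algebra.norm_complex_eq,
    normSq_eq_norm_sq, branch]
  ring

lemma lintegral_image_branch (p : ℤ × ℤ) (F : ℂ → ℝ≥0∞) :
    ∫⁻ w in branch p '' branchDomain p, F w =
      ∫⁻ z in branchDomain p, ‖branch p z‖ₑ ^ 4 * F (branch p z) := by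
  have h : ∀ z, ∃ f' : ℂ →L[ℝ] ℂ, z ∈ branchDomain p →
      HasFDerivAt (branch p) f' z ∧ |f'.det| = ‖branch p z‖ ^ 4 := by
    intro z
    by_cases hz : z ∈ branchDomain p
    · obtain ⟨f', hf'⟩ := hasFDerivAt_branch (ne_zero_of_mem hz.1 p)
      exact ⟨f', fun _ => hf'⟩
    · exact ⟨0, fun h => absurd h hz⟩
  choose f' hf' using h
  rw [lintegral_image_eq_lintegral_abs_det_fderiv_mul volume (measurableSet_branchDomain p)
    (fun z hz => (hf' z hz).1.hasFDerivWithinAt) (injOn_branch p)]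
  refine setLIntegral_congr_fun (measurableSet_branchDomain p) fun z hz => ?_
  rw [(hf' z hz).2, ENNReal.ofReal_pow (norm_nonneg _), ofReal_norm]

/-- Change of variables on each branch image. The images are disjoint because `hurwitzMap` inverts
every branch, and they exhaust the square up to a null set. -/
theorem lintegral_transfer_mul {f g : ℂ → ℝ≥0∞} (hf : Measurable f) (hg : Measurable g) :
    ∫⁻ z in dissectedSquare, transfer f z * g z =
      ∫⁻ z in dissectedSquare, f z * g (hurwitzMap z) := by
  have himg (p : ℤ × ℤ) : MeasurableSet (branch p '' branchDomain p) := by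
    have h : branch p '' branchDomain p =
        dissectedSquare ∩ {w | w⁻¹ - latticePoint p ∈ dissectedSquare} := by
      ext w
      constructor
      · rintro ⟨z, hz, rfl⟩
        exact ⟨hz.2, by simpa [branch] using hz.1⟩
      · rintro ⟨h1, h2⟩
        have h3 : branch p (w⁻¹ - latticePoint p) = w := by simp [branch]
        exact ⟨_, ⟨h2, by rwa [Set.mem_preimage, h3]⟩, h3⟩
    rw [h]
    exact measurableSet_dissectedSquare.inter
      ((measurable_inv.sub_const _) measurableSet_dissectedSquare)
  calc ∫⁻ z in dissectedSquare, transfer f z * g z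
      = ∫⁻ z in dissectedSquare, ∑' p : ℤ × ℤ,
          ‖branch p z‖ₑ ^ 4 * dissectedSquare.indicator f (branch p z) * g z := by
        simp_rw [transfer, ENNReal.tsum_mul_right]
    _ = ∑' p : ℤ × ℤ, ∫⁻ z in dissectedSquare,
          ‖branch p z‖ₑ ^ 4 * dissectedSquare.indicator f (branch p z) * g z :=
        lintegral_tsum fun p => ((((measurable_branch p).enorm.pow_const 4).mul
          ((hf.indicator measurableSet_dissectedSquare).comp
            (measurable_branch p))).mul hg).aemeasurable
    _ = ∑' p : ℤ × ℤ, ∫⁻ w in branch p '' branchDomain p, f w * g (hurwitzMap w) := by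
        refine tsum_congr fun p => ?_
        rw [lintegral_image_branch, branchDomain, Set.inter_comm, ← Measure.restrict_restrict
          (measurable_branch p measurableSet_dissectedSquare), ← lintegral_indicator
          (measurable_branch p measurableSet_dissectedSquare)]
        refine setLIntegral_congr_fun measurableSet_dissectedSquare fun z hz => ?_
        by_cases h : branch p z ∈ dissectedSquare
        · rw [Set.indicator_of_mem h, Set.indicator_of_mem (by exact h), hurwitzMap_branch hz,
            mul_assoc]
        · rw [Set.indicator_of_notMem h, Set.indicator_of_notMem (by exact h)]
          simp
    _ = ∫⁻ w in ⋃ p, branch p '' branchDomain p, f w * g (hurwitzMap w) :=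
        (lintegral_iUnion himg pairwise_disjoint_image_branch _).symm
    _ = _ := setLIntegral_congr iUnion_image_branch_ae_eq

theorem lintegral_transfer_iterate_mul {f g : ℂ → ℝ≥0∞} (hf : Measurable f) (hg : Measurable g)
    (n : ℕ) : ∫⁻ z in dissectedSquare, transfer^[n] f z * g z =
      ∫⁻ z in dissectedSquare, f z * g (hurwitzMap^[n] z) := by
  induction n generalizing f with
  | zero => rfl
  | succ n ih =>
    rw [Function.iterate_succ_apply, ih (measurable_transfer hf)]
    exact lintegral_transfer_mul hf (hg.comp (measurable_hurwitzMap.iterate n))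

/-! ### Contraction and the invariant density -/

lemma transfer_iterate_congr {f g : ℂ → ℝ≥0∞} (h : Set.EqOn f g dissectedSquare) (n : ℕ) :
    Set.EqOn (transfer^[n] f) (transfer^[n] g) dissectedSquare := by
  cases n with
  | zero => exact h
  | succ n => rw [Function.iterate_succ_apply, Function.iterate_succ_apply, transfer_congr h]; exact fun _ _ => rfl

lemma one_le_ofReal_exp {a : ℝ} (ha : 0 ≤ a) : 1 ≤ ENNReal.ofReal (Real.exp a) := by
  simpa using Real.one_le_exp ha

lemma LogLipschitz.const (c : ℝ≥0∞) : LogLipschitz 24 fun _ => c := fun z _ z' _ _ =>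
  le_mul_of_one_le_left zero_le (one_le_ofReal_exp (by positivity))

lemma lintegral_dissectedSquare_const (c : ℝ≥0∞) : ∫⁻ _ in dissectedSquare, c = c := by
  rw [setLIntegral_const, volume_dissectedSquare, mul_one]

lemma lintegral_transfer_iterate {f : ℂ → ℝ≥0∞} (hf : Measurable f) (n : ℕ) :
    ∫⁻ z in dissectedSquare, transfer^[n] f z = ∫⁻ z in dissectedSquare, f z := by
  simpa using lintegral_transfer_iterate_mul hf (measurable_const (a := (1 : ℝ≥0∞))) n

/-- The pointwise minorisation integrated over `z`, with mass preserved; integrating over `w`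
instead gives the lower bound of the next lemma. -/
lemma LogLipschitz.minorant_mul_le_lintegral {f : ℂ → ℝ≥0∞} (hf : LogLipschitz 24 f)
    (hm : Measurable f) {w : ℂ} (hw : w ∈ dissectedSquare) :
    minorant * f w ≤ ∫⁻ z in dissectedSquare, f z := by
  rw [← lintegral_transfer_iterate hm 2, ← lintegral_dissectedSquare_const (minorant * f w)]
  exact setLIntegral_mono' measurableSet_dissectedSquare fun z hz => hf.minorant_mul_le hz hw

lemma LogLipschitz.minorant_mul_lintegral_le {f : ℂ → ℝ≥0∞} (hf : LogLipschitz 24 f)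
    (hm : Measurable f) {z : ℂ} (hz : z ∈ dissectedSquare) :
    minorant * ∫⁻ w in dissectedSquare, f w ≤ _root_.transfer^[2] f z := by
  rw [← lintegral_const_mul _ hm, ← lintegral_dissectedSquare_const (_root_.transfer^[2] f z)]
  exact setLIntegral_mono' measurableSet_dissectedSquare fun w hw => hf.minorant_mul_le hz hw

lemma minorant_ne_top : minorant ≠ ∞ := (minorant_le_one.trans_lt ENNReal.one_lt_top).ne

lemma LogLipschitz.le_inv_minorant {f : ℂ → ℝ≥0∞} (hf : LogLipschitz 24 f)
    (hm : Measurable f) {w : ℂ} (hw : w ∈ dissectedSquare) :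
    f w ≤ minorant⁻¹ * ∫⁻ z in dissectedSquare, f z := by
  have h := hf.minorant_mul_le_lintegral hm hw
  rw [← ENNReal.div_eq_inv_mul, ENNReal.le_div_iff_mul_le (Or.inl minorant_pos.ne')
    (Or.inl minorant_ne_top), mul_comm]
  exact h

/-- Subtracting at most half of the infimum only doubles the log-Lipschitz constant. -/
lemma sub_le_exp_mul_sub {a b c : ℝ≥0∞} {x : ℝ} (hx : 0 ≤ x) (hc : c ≠ ∞) (hb : 2 * c ≤ b)
    (h : a ≤ ENNReal.ofReal (Real.exp x) * b) :
    a - c ≤ ENNReal.ofReal (Real.exp (2 * x)) * (b - c) := by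
  obtain ⟨d, rfl⟩ : ∃ d, b = c + d :=
    exists_add_of_le ((le_mul_of_one_le_left zero_le one_le_two).trans hb)
  obtain ⟨t, ht⟩ := exists_add_of_le (one_le_ofReal_exp hx)
  have hcd : c ≤ d := by
    rw [two_mul] at hb
    exact (ENNReal.add_le_add_iff_left hc).1 hb
  rw [ENNReal.add_sub_cancel_left hc, tsub_le_iff_left, two_mul, ← ofReal_exp_mul]
  refine h.trans ?_
  rw [ht]
  -- With `exp x = 1 + t` and `b = c + d`, the hypothesis `c ≤ d` replaces `t c` by `t d`, and `1 +
  -- 2t ≤ (1 + t)²`.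
  calc (1 + t) * (c + d) = c + (d + t * d + t * c) := by ring
    _ ≤ c + (d + t * d + t * d) := by gcongr
    _ ≤ c + (d + t * d + t * d + t * t * d) := by
      gcongr c + ?_
      exact le_self_add
    _ = c + (1 + t) * (1 + t) * d := by ring

/-- Only half of the Doeblin lower bound is removed, so that the remainder is still log-Lipschitz.
-/
lemma LogLipschitz.exists_decomposition {f : ℂ → ℝ≥0∞} (hf : LogLipschitz 24 f)
    (hm : Measurable f) (hfin : ∫⁻ z in dissectedSquare, f z ≠ ∞) :
    ∃ f₁ : ℂ → ℝ≥0∞, LogLipschitz 24 f₁ ∧ Measurable f₁ ∧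
      Set.EqOn (_root_.transfer^[2] f)
        (f₁ + fun _ => minorant / 2 * ∫⁻ z in dissectedSquare, f z) dissectedSquare ∧
      ∫⁻ z in dissectedSquare, f₁ z = (1 - minorant / 2) * ∫⁻ z in dissectedSquare, f z := by
  set c := minorant / 2 * ∫⁻ z in dissectedSquare, f z with hc
  have hc2 : 2 * c = minorant * ∫⁻ z in dissectedSquare, f z := by
    rw [hc, ← mul_assoc, ENNReal.mul_div_cancel two_ne_zero ENNReal.ofNat_ne_top]
  have hctop : c ≠ ∞ :=
    ENNReal.mul_ne_top (ENNReal.div_ne_top minorant_ne_top two_ne_zero) hfin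
  have hlow (z : ℂ) (hz : z ∈ dissectedSquare) : 2 * c ≤ _root_.transfer^[2] f z :=
    hc2.trans_le (hf.minorant_mul_lintegral_le hm hz)
  have hlow' (z : ℂ) (hz : z ∈ dissectedSquare) : c ≤ _root_.transfer^[2] f z :=
    (le_mul_of_one_le_left zero_le one_le_two).trans (hlow z hz)
  have hmeas := measurable_transfer_iterate hm 2
  refine ⟨fun z => _root_.transfer^[2] f z - c, ?_, hmeas.sub_const c, fun z hz => ?_, ?_⟩
  · intro z hz z' hz' hcell
    -- Two steps take the constant from 24 to 16 to 12, and the subtraction doubles it back to 24.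
    -- This is why the class with constant 24 is used.
    have h1 := ((hf.transfer (by norm_num)).transfer (by norm_num)).mono
      (show (24 / 2 + 4 : ℝ) / 2 + 4 ≤ 12 by norm_num) z hz z' hz' hcell
    have h2 := sub_le_exp_mul_sub (by positivity) hctop (hlow z' hz') h1
    rw [show 24 * ‖z - z'‖ = 2 * (12 * ‖z - z'‖) by ring]
    exact h2
  · exact (tsub_add_cancel_of_le (hlow' z hz)).symm
  · have h : ∫⁻ z in dissectedSquare, (_root_.transfer^[2] f z - c) =
        (∫⁻ z in dissectedSquare, _root_.transfer^[2] f z) - ∫⁻ _ in dissectedSquare, c := by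
      refine lintegral_sub measurable_const ?_ ?_
      · rwa [lintegral_dissectedSquare_const]
      · exact (ae_restrict_mem measurableSet_dissectedSquare).mono hlow'
    rw [h, lintegral_dissectedSquare_const, lintegral_transfer_iterate hm,
      ENNReal.sub_mul fun _ _ => hfin, one_mul]

/-- The rate of contraction of the second iterate of the transfer operator. -/
noncomputable def contractionRate : ℝ≥0∞ := 1 - minorant / 2

lemma contractionRate_lt_one : contractionRate < 1 :=
  ENNReal.sub_lt_self ENNReal.one_ne_top one_ne_zero
    (ENNReal.div_pos minorant_pos.ne' ENNReal.ofNat_ne_top).ne'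

/-- Equal masses make the constants split off from the two functions equal, so their iterates match
on both sides, and induction applies to the remainders, again of equal but smaller mass. -/
theorem LogLipschitz.transfer_iterate_le {f g : ℂ → ℝ≥0∞} (hf : LogLipschitz 24 f)
    (hg : LogLipschitz 24 g) (hfm : Measurable f) (hgm : Measurable g)
    (hfg : ∫⁻ z in dissectedSquare, f z = ∫⁻ z in dissectedSquare, g z)
    (hfin : ∫⁻ z in dissectedSquare, f z ≠ ∞) (n : ℕ) {z : ℂ} (hz : z ∈ dissectedSquare) :
    _root_.transfer^[2 * n] f z ≤ _root_.transfer^[2 * n] g z +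
      minorant⁻¹ * (contractionRate ^ n * ∫⁻ z in dissectedSquare, f z) := by
  induction n generalizing f g with
  | zero =>
    simp only [mul_zero, Function.iterate_zero, id, pow_zero, one_mul]
    exact (hf.le_inv_minorant hfm hz).trans le_add_self
  | succ n ih =>
    obtain ⟨f₁, hf₁, hf₁m, hfe, hfi⟩ := hf.exists_decomposition hfm hfin
    obtain ⟨g₁, hg₁, hg₁m, hge, hgi⟩ := hg.exists_decomposition hgm (hfg ▸ hfin)
    rw [← hfg] at hge hgi
    have h1 := ih hf₁ hg₁ hf₁m hg₁m (hfi.trans hgi.symm)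
      (hfi ▸ ENNReal.mul_ne_top (ENNReal.sub_ne_top ENNReal.one_ne_top) hfin)
    rw [Nat.mul_succ, Function.iterate_add_apply, Function.iterate_add_apply,
      transfer_iterate_congr hfe _ hz, transfer_iterate_congr hge _ hz, transfer_iterate_add,
      transfer_iterate_add]
    simp only [Pi.add_apply]
    rw [hfi] at h1
    exact (add_le_add h1 le_rfl).trans_eq (by unfold contractionRate; ring)

/-! ### The invariant density and the invariant measure -/

/-- The densities of the images of Lebesgue measure on the square. -/
noncomputable def densityIterate (n : ℕ) : ℂ → ℝ≥0∞ := transfer^[n] fun _ => 1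

/-- The invariant density. -/
noncomputable def hurwitzDensity (z : ℂ) : ℝ≥0∞ := limsup (fun n => densityIterate n z) atTop

/-- The uniform distance of the `2 n`-th density from the limit. -/
noncomputable def densityError (n : ℕ) : ℝ≥0∞ := minorant⁻¹ * contractionRate ^ n

lemma tendsto_densityError_mul {c : ℝ≥0∞} (hc : c ≠ ∞) :
    Tendsto (fun n => densityError n * c) atTop (𝓝 0) := by
  have h := ENNReal.tendsto_pow_atTop_nhds_zero_of_lt_one contractionRate_lt_one
  have h2 := ENNReal.Tendsto.const_mul (a := minorant⁻¹) h
    (Or.inr (ENNReal.inv_ne_top.2 minorant_pos.ne'))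
  have h3 := ENNReal.Tendsto.mul_const (b := c) h2 (Or.inr hc)
  simpa [densityError] using h3

lemma tendsto_densityError : Tendsto densityError atTop (𝓝 0) := by
  simpa using tendsto_densityError_mul ENNReal.one_ne_top

lemma measurable_densityIterate (n : ℕ) : Measurable (densityIterate n) :=
  measurable_transfer_iterate measurable_const n

lemma logLipschitz_densityIterate (n : ℕ) : LogLipschitz 24 (densityIterate n) :=
  (LogLipschitz.const 1).iterate n

lemma lintegral_densityIterate (n : ℕ) : ∫⁻ z in dissectedSquare, densityIterate n z = 1 := by
  rw [densityIterate, lintegral_transfer_iterate measurable_const, lintegral_dissectedSquare_const]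

/-- A uniform Cauchy estimate: past index `2 * n` all iterates of 1 are `2 * n`-fold transfers of
log-Lipschitz densities of mass 1. So the `limsup` defining `hurwitzDensity` is a uniform limit on
`dissectedSquare`. -/
lemma densityIterate_le_add {n a b : ℕ} (ha : 2 * n ≤ a) (hb : 2 * n ≤ b) {z : ℂ}
    (hz : z ∈ dissectedSquare) :
    densityIterate a z ≤ densityIterate b z + densityError n := by
  obtain ⟨k, rfl⟩ := Nat.exists_eq_add_of_le ha
  obtain ⟨l, rfl⟩ := Nat.exists_eq_add_of_le hb
  have h := (logLipschitz_densityIterate k).transfer_iterate_le (logLipschitz_densityIterate l)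
    (measurable_densityIterate k) (measurable_densityIterate l)
    (by rw [lintegral_densityIterate, lintegral_densityIterate])
    (by rw [lintegral_densityIterate]; exact ENNReal.one_ne_top) n hz
  rw [lintegral_densityIterate, mul_one] at h
  simpa only [densityIterate, densityError, ← Function.iterate_add_apply] using h

lemma measurable_hurwitzDensity : Measurable hurwitzDensity :=
  Measurable.limsup fun n => measurable_densityIterate n

lemma hurwitzDensity_le {n b : ℕ} (hb : 2 * n ≤ b) {z : ℂ} (hz : z ∈ dissectedSquare) :
    hurwitzDensity z ≤ densityIterate b z + densityError n :=
  limsup_le_of_le (h := (eventually_ge_atTop (2 * n)).mono fun _ ha =>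
    densityIterate_le_add ha hb hz)

lemma le_hurwitzDensity {n a : ℕ} (ha : 2 * n ≤ a) {z : ℂ} (hz : z ∈ dissectedSquare) :
    densityIterate a z ≤ hurwitzDensity z + densityError n := by
  rw [← tsub_le_iff_right]
  refine le_limsup_of_frequently_le ((eventually_ge_atTop (2 * n)).mono fun b hb => ?_).frequently
  rw [tsub_le_iff_right]
  exact densityIterate_le_add ha hb hz

lemma densityIterate_le_inv (n : ℕ) {z : ℂ} (hz : z ∈ dissectedSquare) :
    densityIterate n z ≤ minorant⁻¹ := by
  have h := (logLipschitz_densityIterate n).le_inv_minorant (measurable_densityIterate n) hz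
  rwa [lintegral_densityIterate, mul_one] at h

lemma hurwitzDensity_le_inv {z : ℂ} (hz : z ∈ dissectedSquare) :
    hurwitzDensity z ≤ minorant⁻¹ :=
  limsup_le_of_le (h := Eventually.of_forall fun n => densityIterate_le_inv n hz)

lemma hurwitzDensity_lt_top {z : ℂ} (hz : z ∈ dissectedSquare) : hurwitzDensity z < ∞ :=
  (hurwitzDensity_le_inv hz).trans_lt (ENNReal.inv_lt_top.2 minorant_pos)

lemma minorant_le_hurwitzDensity {z : ℂ} (hz : z ∈ dissectedSquare) :
    minorant ≤ hurwitzDensity z := by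
  refine le_limsup_of_frequently_le ((eventually_ge_atTop 2).mono fun b hb => ?_).frequently
  obtain ⟨k, rfl⟩ := Nat.exists_eq_add_of_le hb
  have h := (logLipschitz_densityIterate k).minorant_mul_lintegral_le (measurable_densityIterate k) hz
  rw [lintegral_densityIterate, mul_one] at h
  rwa [densityIterate, Function.iterate_add_apply]

lemma logLipschitz_hurwitzDensity : LogLipschitz 24 hurwitzDensity := by
  intro z hz z' hz' hc
  set E := ENNReal.ofReal (Real.exp (24 * ‖z - z'‖)) with hE
  have h1 (n : ℕ) : hurwitzDensity z ≤ E * hurwitzDensity z' + densityError n * (E + 1) := by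
    calc hurwitzDensity z ≤ densityIterate (2 * n) z + densityError n := hurwitzDensity_le (n := n) le_rfl hz
      _ ≤ E * densityIterate (2 * n) z' + densityError n := by
        gcongr
        exact logLipschitz_densityIterate _ z hz z' hz' hc
      _ ≤ E * (hurwitzDensity z' + densityError n) + densityError n := by
        gcongr
        exact le_hurwitzDensity le_rfl hz'
      _ = _ := by ring
  refine ge_of_tendsto' (x := atTop) ?_ h1
  have := (tendsto_densityError_mul (c := E + 1) (by simp [hE])).const_add
    (E * hurwitzDensity z')
  simpa using this

/-- The invariant measure. -/
noncomputable def hurwitzMeasure : Measure ℂ :=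
  (volume.restrict dissectedSquare).withDensity hurwitzDensity

lemma hurwitzMeasure_apply {s : Set ℂ} (hs : MeasurableSet s) :
    hurwitzMeasure s = ∫⁻ z in dissectedSquare, hurwitzDensity z * s.indicator 1 z := by
  rw [hurwitzMeasure, withDensity_apply _ hs, ← lintegral_indicator hs]
  refine lintegral_congr fun z => ?_
  by_cases h : z ∈ s <;> simp [h]

lemma lintegral_add_error_le {f g s : ℂ → ℝ≥0∞} {c : ℝ≥0∞} (hs1 : ∀ z, s z ≤ 1)
    (h : ∀ z ∈ dissectedSquare, f z ≤ g z + c) :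
    ∫⁻ z in dissectedSquare, f z * s z ≤ (∫⁻ z in dissectedSquare, g z * s z) + c := by
  calc ∫⁻ z in dissectedSquare, f z * s z ≤ ∫⁻ z in dissectedSquare, (g z * s z + c) := by
        refine setLIntegral_mono' measurableSet_dissectedSquare fun z hz => ?_
        calc f z * s z ≤ (g z + c) * s z := by gcongr; exact h z hz
          _ = g z * s z + c * s z := add_mul _ _ _
          _ ≤ g z * s z + c := by
            gcongr
            exact mul_le_of_le_one_right zero_le (hs1 z)
    _ = _ := by
      rw [lintegral_add_right _ measurable_const, lintegral_dissectedSquare_const]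

lemma indicator_one_le (s : Set ℂ) (z : ℂ) : s.indicator (1 : ℂ → ℝ≥0∞) z ≤ 1 :=
  Set.indicator_le_self' (fun _ _ => zero_le) z

lemma measurable_indicator_one {s : Set ℂ} (hs : MeasurableSet s) :
    Measurable (s.indicator (1 : ℂ → ℝ≥0∞)) := measurable_one.indicator hs

lemma lintegral_hurwitzDensity : ∫⁻ z in dissectedSquare, hurwitzDensity z = 1 := by
  have h1 (n : ℕ) : ∫⁻ z in dissectedSquare, hurwitzDensity z ≤ 1 + densityError n := by
    have := lintegral_add_error_le (s := 1) (fun _ => le_rfl) fun z hz => hurwitzDensity_le (n := n) le_rfl hz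
    simpa [lintegral_densityIterate] using this
  have h2 (n : ℕ) : 1 ≤ (∫⁻ z in dissectedSquare, hurwitzDensity z) + densityError n := by
    have := lintegral_add_error_le (s := 1) (fun _ => le_rfl) fun z hz => le_hurwitzDensity (n := n) le_rfl hz
    simpa [lintegral_densityIterate] using this
  refine le_antisymm (ge_of_tendsto' (x := atTop) ?_ h1) (ge_of_tendsto' (x := atTop) ?_ h2)
  · simpa using tendsto_densityError.const_add 1
  · simpa using tendsto_densityError.const_add (∫⁻ z in dissectedSquare, hurwitzDensity z)

instance : IsProbabilityMeasure hurwitzMeasure where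
  measure_univ := by
    rw [hurwitzMeasure_apply .univ]
    simpa using lintegral_hurwitzDensity

/-- Replace the density by an iterate, move one step by duality, and return to the density. An
inequality is enough, because both sides define probability measures. -/
lemma hurwitzMeasure_preimage_le {s : Set ℂ} (hs : MeasurableSet s) :
    hurwitzMeasure s ≤ hurwitzMeasure (hurwitzMap ⁻¹' s) := by
  rw [hurwitzMeasure_apply hs, hurwitzMeasure_apply (measurable_hurwitzMap hs)]
  have hi := measurable_indicator_one hs
  have h (n : ℕ) : ∫⁻ z in dissectedSquare, hurwitzDensity z * s.indicator 1 z ≤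
      (∫⁻ z in dissectedSquare, hurwitzDensity z * (hurwitzMap ⁻¹' s).indicator 1 z) +
        densityError n * 2 := by
    calc _ ≤ (∫⁻ z in dissectedSquare, densityIterate (2 * n + 1) z * s.indicator 1 z) +
          densityError n :=
        lintegral_add_error_le (indicator_one_le s)
          fun z hz => hurwitzDensity_le (by omega) hz
      _ = (∫⁻ z in dissectedSquare, densityIterate (2 * n) z *
          (hurwitzMap ⁻¹' s).indicator 1 z) + densityError n := by
        congr 1
        rw [densityIterate, Function.iterate_succ_apply']
        exact lintegral_transfer_mul (measurable_densityIterate _) hi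
      _ ≤ ((∫⁻ z in dissectedSquare, hurwitzDensity z * (hurwitzMap ⁻¹' s).indicator 1 z) +
          densityError n) + densityError n := by
        gcongr
        exact lintegral_add_error_le (indicator_one_le _)
          fun z hz => le_hurwitzDensity le_rfl hz
      _ = _ := by ring
  refine ge_of_tendsto' (x := atTop) ?_ h
  simpa using (tendsto_densityError_mul ENNReal.ofNat_ne_top).const_add
    (∫⁻ z in dissectedSquare, hurwitzDensity z * (hurwitzMap ⁻¹' s).indicator 1 z)

lemma eq_of_forall_measure_le {μ ν : Measure ℂ} [IsProbabilityMeasure μ] [IsProbabilityMeasure ν]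
    (h : ∀ s, MeasurableSet s → μ s ≤ ν s) : μ = ν :=
  Measure.eq_of_le_of_isProbabilityMeasure (Measure.le_iff.2 h)

lemma isHurwitzMeasure_hurwitzMeasure : IsHurwitzMeasure hurwitzMeasure where
  isProbabilityMeasure := inferInstance
  carried := by
    have h : volume.restrict dissectedSquare hurwitzSquareᶜ = 0 := by
      rw [Measure.restrict_apply₀' measurableSet_dissectedSquare.nullMeasurableSet]
      refine measure_mono_null ?_ measure_empty
      rintro z ⟨h1, h2⟩
      exact h1 (dissectedSquare_subset h2)
    exact withDensity_absolutelyContinuous _ _ h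
  absolutelyContinuous :=
    (withDensity_absolutelyContinuous _ _).trans Measure.restrict_le_self.absolutelyContinuous
  invariant := by
    refine ⟨measurable_hurwitzMap, ?_⟩
    have := Measure.isProbabilityMeasure_map (μ := hurwitzMeasure)
      measurable_hurwitzMap.aemeasurable
    refine (eq_of_forall_measure_le fun s hs => ?_).symm
    rw [Measure.map_apply measurable_hurwitzMap hs]
    exact hurwitzMeasure_preimage_le hs

/-! ### Uniqueness -/

/-- Adding `K` makes the relative variation small: `K d ≤ d (g + K)` on the positive part, and `1 +
d ≤ exp (24 d)`. -/
lemma LipschitzWith.logLipschitz_add {K : ℝ≥0} {g : ℂ → ℝ} (hg : LipschitzWith K g) :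
    LogLipschitz 24 fun z => ENNReal.ofReal (g z) + K := by
  intro z _ z' _ _
  have h1 : ENNReal.ofReal (g z) ≤
      ENNReal.ofReal (g z') + K * ENNReal.ofReal ‖z - z'‖ := by
    rw [← ENNReal.ofReal_coe_nnreal (p := K), ← ENNReal.ofReal_mul (NNReal.coe_nonneg K)]
    refine (ENNReal.ofReal_le_ofReal ?_).trans ENNReal.ofReal_add_le
    have := hg.dist_le_mul z z'
    rw [Real.dist_eq, dist_eq_norm] at this
    linarith [le_abs_self (g z - g z')]
  have h2 : 1 + ENNReal.ofReal ‖z - z'‖ ≤ ENNReal.ofReal (Real.exp (24 * ‖z - z'‖)) := by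
    rw [← ENNReal.ofReal_one, ← ENNReal.ofReal_add zero_le_one (norm_nonneg _)]
    refine ENNReal.ofReal_le_ofReal ?_
    have := Real.add_one_le_exp (24 * ‖z - z'‖)
    linarith [norm_nonneg (z - z')]
  calc ENNReal.ofReal (g z) + K
      ≤ ENNReal.ofReal (g z') + K * ENNReal.ofReal ‖z - z'‖ + K := by gcongr
    _ ≤ ENNReal.ofReal (g z') + K * ENNReal.ofReal ‖z - z'‖ + K +
        ENNReal.ofReal ‖z - z'‖ * ENNReal.ofReal (g z') := le_self_add
    _ = (1 + ENNReal.ofReal ‖z - z'‖) * (ENNReal.ofReal (g z') + K) := by ring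
    _ ≤ _ := by gcongr

/-- The iterates of `φ` converge to a multiple of the invariant density if `φ + c` is
log-Lipschitz for some constant `c`. -/
lemma transfer_iterate_le_of_add_const {φ : ℂ → ℝ≥0∞} (hφ : Measurable φ) {c : ℝ≥0∞}
    (hc : c ≠ ∞) (h : LogLipschitz 24 fun z => φ z + c)
    (hfin : ∫⁻ z in dissectedSquare, φ z ≠ ∞) (n : ℕ) {z : ℂ} (hz : z ∈ dissectedSquare) :
    transfer^[2 * n] φ z ≤ (∫⁻ z in dissectedSquare, φ z) * densityIterate (2 * n) z +
      densityError n * ((∫⁻ z in dissectedSquare, φ z) + c) := by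
  set m := ∫⁻ z in dissectedSquare, φ z with hm
  have hint : ∫⁻ z in dissectedSquare, (φ z + c) = m + c := by
    rw [lintegral_add_left hφ, lintegral_dissectedSquare_const]
  have key := h.transfer_iterate_le (LogLipschitz.const (m + c)) (hφ.add_const c) measurable_const
    (by rw [hint, lintegral_dissectedSquare_const]) (by rw [hint]; exact ENNReal.add_ne_top.2 ⟨hfin, hc⟩)
    n hz
  rw [hint] at key
  have e1 : (fun z => φ z + c) = φ + fun z => c * (fun _ => 1) z := by ext; simp
  have e2 : (fun _ : ℂ => m + c) = fun z => (m + c) * (fun _ => 1) z := by ext; simp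
  rw [e1, e2, transfer_iterate_add, transfer_iterate_const_mul, transfer_iterate_const_mul] at key
  change transfer^[2 * n] φ z + c * densityIterate (2 * n) z ≤
    (m + c) * densityIterate (2 * n) z + _ at key
  -- Finiteness allows the contribution of the auxiliary constant `c` to be cancelled in `ℝ≥0∞`.
  have hctop : c * densityIterate (2 * n) z ≠ ∞ :=
    ENNReal.mul_ne_top hc ((densityIterate_le_inv _ hz).trans_lt
      (ENNReal.inv_lt_top.2 minorant_pos)).ne
  refine (ENNReal.add_le_add_iff_right hctop).1 (key.trans_eq ?_)
  unfold densityError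
  ring

/-- Compactly supported smooth functions are dense in L¹ and Lipschitz. The upper bound on `φ`
controls its mass, the lower bound controls the measure being compared. -/
lemma exists_logLipschitz_approx {F : ℂ → ℝ≥0∞} (hF : Measurable F)
    (hfin : ∫⁻ z, F z ≠ ∞) {ε : ℝ} (hε : 0 < ε) :
    ∃ φ : ℂ → ℝ≥0∞, ∃ c : ℝ≥0∞, ∃ e : ℂ → ℝ≥0∞, Measurable φ ∧ c ≠ ∞ ∧ Measurable e ∧
      LogLipschitz 24 (fun z => φ z + c) ∧ (∀ᵐ z, F z ≤ φ z + e z) ∧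
      (∀ᵐ z, φ z ≤ F z + e z) ∧ ∫⁻ z, e z ≤ ENNReal.ofReal ε := by
  have hae : ∀ᵐ z, F z < ∞ := ae_lt_top hF hfin
  have hint : Integrable (fun z => (F z).toReal) volume :=
    integrable_toReal_of_lintegral_ne_top hF.aemeasurable hfin
  obtain ⟨g, hg1, hg2, hg3⟩ := (memLp_one_iff_integrable.2 hint).exist_eLpNorm_sub_le
    ENNReal.one_ne_top le_rfl hε
  obtain ⟨K, hK⟩ := ContDiff.lipschitzWith_of_hasCompactSupport hg1 hg2 (by simp)
  have hgm : Measurable g := hg2.continuous.measurable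
  refine ⟨fun z => ENNReal.ofReal (g z), K, fun z => ‖(F z).toReal - g z‖ₑ, hgm.ennreal_ofReal,
    ENNReal.coe_ne_top, (hF.ennreal_toReal.sub hgm).enorm, hK.logLipschitz_add, ?_, ?_, ?_⟩
  · filter_upwards [hae] with z hz
    calc F z = ENNReal.ofReal (g z + ((F z).toReal - g z)) := by
          rw [add_sub_cancel, ENNReal.ofReal_toReal hz.ne]
      _ ≤ ENNReal.ofReal (g z) + ENNReal.ofReal ((F z).toReal - g z) := ENNReal.ofReal_add_le
      _ ≤ _ := by
          gcongr
          rw [← ofReal_norm, Real.norm_eq_abs]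
          exact ENNReal.ofReal_le_ofReal (le_abs_self _)
  · filter_upwards [hae] with z hz
    calc ENNReal.ofReal (g z) = ENNReal.ofReal ((F z).toReal + (g z - (F z).toReal)) := by
          rw [add_sub_cancel]
      _ ≤ ENNReal.ofReal (F z).toReal + ENNReal.ofReal (g z - (F z).toReal) :=
          ENNReal.ofReal_add_le
      _ ≤ _ := by
          rw [ENNReal.ofReal_toReal hz.ne]
          gcongr
          rw [← ofReal_norm, Real.norm_eq_abs, abs_sub_comm]
          exact ENNReal.ofReal_le_ofReal (le_abs_self _)
  · simpa [eLpNorm_one_eq_lintegral_enorm] using hg3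

lemma IsHurwitzMeasure.measure_dissectedSquare_compl {ν : Measure ℂ} (h : IsHurwitzMeasure ν) :
    ν dissectedSquareᶜ = 0 := by
  have h1 : dissectedSquare =ᵐ[ν] hurwitzSquare := h.absolutelyContinuous.ae_le dissectedSquare_ae_eq
  rw [measure_congr h1.compl, h.carried]

lemma IsHurwitzMeasure.apply_eq {ν : Measure ℂ} (h : IsHurwitzMeasure ν) {s : Set ℂ}
    (hs : MeasurableSet s) :
    ν s = ∫⁻ z in dissectedSquare, ν.rnDeriv volume z * s.indicator 1 z := by
  have := h.isProbabilityMeasure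
  calc ν s = ν (s ∩ dissectedSquare) :=
        (measure_inter_conull' (measure_mono_null (Set.sdiff_subset_compl _ _)
          h.measure_dissectedSquare_compl)).symm
    _ = ∫⁻ z in s ∩ dissectedSquare, ν.rnDeriv volume z :=
        (Measure.setLIntegral_rnDeriv h.absolutelyContinuous _).symm
    _ = _ := by
        rw [← Measure.restrict_restrict hs, ← lintegral_indicator hs]
        refine lintegral_congr fun z => ?_
        by_cases hz : z ∈ s <;> simp [hz]

/-- By invariance `s` may be replaced by its preimage under `2 * n` steps. After approximation of
the density, duality moves these steps onto `φ`, whose iterates tend to its mass times the invariant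
density. -/
lemma IsHurwitzMeasure.le_hurwitzMeasure {ν : Measure ℂ} (h : IsHurwitzMeasure ν) {s : Set ℂ}
    (hs : MeasurableSet s) {ε : ℝ} (hε : 0 < ε) :
    ν s ≤ (1 + ENNReal.ofReal ε) * hurwitzMeasure s + ENNReal.ofReal ε := by
  have := h.isProbabilityMeasure
  set F := ν.rnDeriv volume
  have hF : Measurable F := Measure.measurable_rnDeriv ν volume
  have hF1 : ∫⁻ z, F z = 1 := by
    rw [Measure.lintegral_rnDeriv h.absolutelyContinuous, measure_univ]
  obtain ⟨φ, c, e, hφ, hc, he, hL, h1, h2, h3⟩ :=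
    exists_logLipschitz_approx hF (by simp [hF1]) hε
  have he' : ∫⁻ z in dissectedSquare, e z ≤ ENNReal.ofReal ε :=
    (setLIntegral_le_lintegral _ _).trans h3
  set m := ∫⁻ z in dissectedSquare, φ z with hm
  have hm1 : m ≤ 1 + ENNReal.ofReal ε := by
    calc m ≤ ∫⁻ z in dissectedSquare, (F z + e z) := lintegral_mono_ae (ae_restrict_of_ae h2)
      _ = (∫⁻ z in dissectedSquare, F z) + ∫⁻ z in dissectedSquare, e z := lintegral_add_left hF _
      _ ≤ 1 + ENNReal.ofReal ε := add_le_add ((setLIntegral_le_lintegral _ _).trans_eq hF1) he'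
  have hmfin : m ≠ ∞ := (hm1.trans_lt (by simp)).ne
  have hi := measurable_indicator_one hs
  have key (n : ℕ) : ν s ≤ m * hurwitzMeasure s + ENNReal.ofReal ε +
      densityError n * (m + (m + c)) := by
    have hT := measurable_hurwitzMap.iterate (2 * n)
    calc ν s = ν (hurwitzMap^[2 * n] ⁻¹' s) :=
          ((h.invariant.iterate (2 * n)).measure_preimage hs.nullMeasurableSet).symm
      _ = ∫⁻ z in dissectedSquare, F z * (hurwitzMap^[2 * n] ⁻¹' s).indicator 1 z :=
          h.apply_eq (hT hs)
      _ ≤ ∫⁻ z in dissectedSquare, (φ z * (hurwitzMap^[2 * n] ⁻¹' s).indicator 1 z + e z) := by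
          refine lintegral_mono_ae (ae_restrict_of_ae (h1.mono fun z hz => ?_))
          calc _ ≤ (φ z + e z) * (hurwitzMap^[2 * n] ⁻¹' s).indicator 1 z := by gcongr
            _ = _ := add_mul _ _ _
            _ ≤ _ := by
              gcongr
              exact mul_le_of_le_one_right zero_le (indicator_one_le _ z)
      _ = (∫⁻ z in dissectedSquare, φ z * (hurwitzMap^[2 * n] ⁻¹' s).indicator 1 z) +
          ∫⁻ z in dissectedSquare, e z := lintegral_add_right _ he
      _ ≤ (∫⁻ z in dissectedSquare, transfer^[2 * n] φ z * s.indicator 1 z) +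
          ENNReal.ofReal ε := by
          exact add_le_add (lintegral_transfer_iterate_mul hφ hi _).ge he'
      _ ≤ ((∫⁻ z in dissectedSquare, m * hurwitzDensity z * s.indicator 1 z) +
          densityError n * (m + (m + c))) + ENNReal.ofReal ε := by
          gcongr
          refine lintegral_add_error_le (indicator_one_le s) fun z hz => ?_
          refine (transfer_iterate_le_of_add_const hφ hc hL hmfin n hz).trans ?_
          calc _ ≤ m * (hurwitzDensity z + densityError n) + densityError n * (m + c) := by
                gcongr
                exact le_hurwitzDensity le_rfl hz
            _ = _ := by ring
      _ = _ := by
          have hmul := lintegral_const_mul (μ := volume.restrict dissectedSquare) m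
            (measurable_hurwitzDensity.mul hi)
          simp only [Pi.mul_apply, ← mul_assoc] at hmul
          rw [hurwitzMeasure_apply hs, hmul]
          ring
  calc ν s ≤ m * hurwitzMeasure s + ENNReal.ofReal ε := by
        refine ge_of_tendsto' (x := atTop) ?_ key
        simpa using (tendsto_densityError_mul (c := m + (m + c)) (by simp [hmfin, hc])).const_add
          (m * hurwitzMeasure s + ENNReal.ofReal ε)
    _ ≤ _ := by gcongr

theorem IsHurwitzMeasure.eq_hurwitzMeasure {ν : Measure ℂ} (h : IsHurwitzMeasure ν) :
    ν = hurwitzMeasure := by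
  have := h.isProbabilityMeasure
  refine eq_of_forall_measure_le fun s hs => ?_
  have h1 : Tendsto (fun ε : ℝ => (1 + ENNReal.ofReal ε) * hurwitzMeasure s + ENNReal.ofReal ε)
      (𝓝[>] 0) (𝓝 (hurwitzMeasure s)) := by
    have h2 : Tendsto (fun ε : ℝ => ENNReal.ofReal ε) (𝓝[>] 0) (𝓝 0) := by
      have := (ENNReal.continuous_ofReal.tendsto 0).mono_left
        (nhdsWithin_le_nhds (s := Set.Ioi (0 : ℝ)))
      simpa using this
    have h3 := (ENNReal.Tendsto.mul_const (b := hurwitzMeasure s) (h2.const_add 1)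
      (Or.inr (measure_ne_top _ _))).add h2
    simpa using h3
  exact ge_of_tendsto h1 (eventually_mem_nhdsWithin.mono fun ε hε => h.le_hurwitzMeasure hs hε)

/-! ### Rotation invariance and regularity of the density -/

lemma latticeDistSq_I_mul (z : ℂ) (m n : ℤ) :
    latticeDistSq (I * z) m n = latticeDistSq z n (-m) := by
  simp [latticeDistSq]
  ring

lemma I_mul_mem_dissectedSquare_iff {z : ℂ} : I * z ∈ dissectedSquare ↔ z ∈ dissectedSquare := by
  rw [mem_dissectedSquare_iff, mem_dissectedSquare_iff]
  simp only [latticeDistSq_I_mul]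
  have h : (∀ m n : ℤ, latticeDistSq z n (-m) ≠ 1) ↔ ∀ m n : ℤ, latticeDistSq z m n ≠ 1 :=
    ⟨fun h m n => by simpa using h (-n) m, fun h m n => h n (-m)⟩
  rw [h]
  simp
  tauto

lemma branch_I_mul (p : ℤ × ℤ) (z : ℂ) : branch p (I * z) = (-I) * branch (p.2, -p.1) z := by
  unfold branch latticePoint
  rw [← inv_I, ← mul_inv]
  congr 1
  push_cast
  linear_combination (p.1 : ℂ) * I_mul_I

/-- Multiplication by `-i` on the Gaussian integers. -/
def rotateLattice : ℤ × ℤ ≃ ℤ × ℤ where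
  toFun p := (p.2, -p.1)
  invFun p := (-p.2, p.1)
  left_inv p := by simp
  right_inv p := by simp

/-- Rotating the point by `i` permutes the digits and rotates the branch values, which changes
neither the Jacobians nor `f`. Starting from the constant 1, all iterates inherit the symmetry. -/
lemma transfer_I_mul {f : ℂ → ℝ≥0∞} (hf : ∀ z, f (I * z) = f z) (z : ℂ) :
    transfer f (I * z) = transfer f z := by
  have hind (w : ℂ) : dissectedSquare.indicator f (-I * w) = dissectedSquare.indicator f w := by
    have h1 : w = I * (-I * w) := by linear_combination w * I_mul_I
    conv_rhs => rw [h1]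
    by_cases h : -I * w ∈ dissectedSquare
    · rw [Set.indicator_of_mem h, Set.indicator_of_mem (I_mul_mem_dissectedSquare_iff.2 h), hf]
    · rw [Set.indicator_of_notMem h,
        Set.indicator_of_notMem (fun h' => h (I_mul_mem_dissectedSquare_iff.1 h'))]
  unfold transfer
  refine Eq.trans (tsum_congr fun p => ?_) (rotateLattice.tsum_eq fun p =>
    ‖branch p z‖ₑ ^ 4 * dissectedSquare.indicator f (branch p z))
  rw [branch_I_mul, hind]
  congr 2
  simp [rotateLattice, ← ofReal_norm]

lemma densityIterate_I_mul (n : ℕ) (z : ℂ) : densityIterate n (I * z) = densityIterate n z := by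
  induction n generalizing z with
  | zero => rfl
  | succ n ih =>
    have h : densityIterate (n + 1) = transfer (densityIterate n) := by
      ext; simp only [densityIterate, Function.iterate_succ_apply']
    rw [h]
    exact transfer_I_mul ih z

lemma hurwitzDensity_I_mul (z : ℂ) : hurwitzDensity (I * z) = hurwitzDensity z := by
  simp only [hurwitzDensity, densityIterate_I_mul]

/-- The invariant density as a real function vanishing off the dissected square. -/
noncomputable def realDensity (z : ℂ) : ℝ := (dissectedSquare.indicator hurwitzDensity z).toReal

lemma realDensity_of_mem {z : ℂ} (hz : z ∈ dissectedSquare) :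
    realDensity z = (hurwitzDensity z).toReal := by
  rw [realDensity, Set.indicator_of_mem hz]

lemma measurable_realDensity : Measurable realDensity :=
  (measurable_hurwitzDensity.indicator measurableSet_dissectedSquare).ennreal_toReal

lemma realDensity_nonneg (z : ℂ) : 0 ≤ realDensity z := ENNReal.toReal_nonneg

lemma realDensity_le (z : ℂ) : realDensity z ≤ minorant⁻¹.toReal := by
  refine ENNReal.toReal_mono (ENNReal.inv_ne_top.2 minorant_pos.ne') ?_
  by_cases hz : z ∈ dissectedSquare
  · rw [Set.indicator_of_mem hz]
    exact hurwitzDensity_le_inv hz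
  · rw [Set.indicator_of_notMem hz]
    exact zero_le

lemma realDensity_I_mul (z : ℂ) : realDensity (I * z) = realDensity z := by
  unfold realDensity
  by_cases h : z ∈ dissectedSquare
  · rw [Set.indicator_of_mem h, Set.indicator_of_mem (I_mul_mem_dissectedSquare_iff.2 h),
      hurwitzDensity_I_mul]
  · rw [Set.indicator_of_notMem h,
      Set.indicator_of_notMem (fun h' => h (I_mul_mem_dissectedSquare_iff.1 h'))]

lemma minorant_le_realDensity {z : ℂ} (hz : z ∈ dissectedSquare) :
    minorant.toReal ≤ realDensity z := by
  rw [realDensity_of_mem hz]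
  exact ENNReal.toReal_mono (hurwitzDensity_lt_top hz).ne (minorant_le_hurwitzDensity hz)

/-- The Lipschitz constant of the invariant density on each cell. -/
noncomputable def densityLipschitzConstant : ℝ≥0 :=
  ⟨minorant⁻¹.toReal * (24 * Real.exp 48), by positivity⟩

lemma realDensity_sub_le {z z' : ℂ} (hz : z ∈ dissectedSquare) (hz' : z' ∈ dissectedSquare)
    (hc : SameCell z z') :
    realDensity z - realDensity z' ≤ densityLipschitzConstant * ‖z - z'‖ := by
  have h1 := ENNReal.toReal_mono
    (ENNReal.mul_ne_top ENNReal.ofReal_ne_top (hurwitzDensity_lt_top hz').ne)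
    (logLipschitz_hurwitzDensity z hz z' hz' hc)
  rw [ENNReal.toReal_mul, ENNReal.toReal_ofReal (Real.exp_pos _).le, ← realDensity_of_mem hz,
    ← realDensity_of_mem hz'] at h1
  set d := ‖z - z'‖ with hd
  have hd0 : 0 ≤ d := norm_nonneg _
  have hd2 : d ≤ 2 := norm_sub_le_two hz hz'
  -- From `1 - exp (-x) ≤ x`, multiplied by `exp x`, with `x = 24 d ≤ 48`.
  have h2 : Real.exp (24 * d) - 1 ≤ 24 * d * Real.exp 48 := by
    have h3 : 1 - 24 * d ≤ Real.exp (-(24 * d)) := by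
      linarith [Real.add_one_le_exp (-(24 * d))]
    have h4 : Real.exp (24 * d) ≤ Real.exp 48 := Real.exp_le_exp.2 (by linarith)
    have h5 : Real.exp (24 * d) * Real.exp (-(24 * d)) = 1 := by
      rw [← Real.exp_add]; simp
    nlinarith [Real.exp_pos (24 * d)]
  have h6 := realDensity_le z'
  have h7 := realDensity_nonneg z'
  have h8 : (0 : ℝ) ≤ 24 * d * Real.exp 48 := by positivity
  change _ ≤ minorant⁻¹.toReal * (24 * Real.exp 48) * d
  nlinarith

lemma dist_realDensity_le {z z' : ℂ} (hz : z ∈ dissectedSquare) (hz' : z' ∈ dissectedSquare)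
    (hc : SameCell z z') :
    dist (realDensity z) (realDensity z') ≤ densityLipschitzConstant * dist z z' := by
  rw [Real.dist_eq, dist_eq_norm, abs_sub_le_iff]
  refine ⟨realDensity_sub_le hz hz' hc, ?_⟩
  rw [norm_sub_rev]
  exact realDensity_sub_le hz' hz hc.symm

lemma eventually_sameCell {z : ℂ} (hz : z ∈ dissectedSquare) :
    ∀ᶠ z' in 𝓝[dissectedSquare] z, SameCell z z' := by
  obtain ⟨h1, h2, h3⟩ := mem_dissectedSquare_iff.1 hz
  have hcont (m n : ℤ) : Continuous fun w : ℂ => latticeDistSq w m n := by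
    unfold latticeDistSq
    fun_prop
  have hev (p : ℤ × ℤ) :
      ∀ᶠ z' in 𝓝 z, (latticeDistSq z p.1 p.2 < 1 ↔ latticeDistSq z' p.1 p.2 < 1) := by
    rcases lt_or_gt_of_ne (h3 p.1 p.2) with h | h
    · filter_upwards [(hcont p.1 p.2).continuousAt.eventually_lt_const h] with z' hz'
      exact iff_of_true h hz'
    · filter_upwards [(hcont p.1 p.2).continuousAt.eventually_const_lt h] with z' hz'
      exact iff_of_false h.not_gt hz'.not_gt
  -- Only the nine centres with coordinates in `{-1, 0, 1}` matter, so finitely many open conditions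
  -- suffice.
  have hfin := (Finset.eventually_all (Finset.Icc (-1 : ℤ) 1 ×ˢ Finset.Icc (-1 : ℤ) 1)).2
    fun p _ => hev p
  filter_upwards [nhdsWithin_le_nhds hfin, self_mem_nhdsWithin] with z' hz' hmem m n
  obtain ⟨h1', h2', -⟩ := mem_dissectedSquare_iff.1 hmem
  by_cases hmn : (m, n) ∈ Finset.Icc (-1 : ℤ) 1 ×ˢ Finset.Icc (-1 : ℤ) 1
  · exact hz' (m, n) hmn
  · simp only [Finset.mem_product, Finset.mem_Icc] at hmn
    exact iff_of_false (fun h => hmn (latticeDistSq_le_one h1 h2 h.le))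
      (fun h => hmn (latticeDistSq_le_one h1' h2' h.le))

lemma continuousOn_realDensity : ContinuousOn realDensity dissectedSquare := by
  intro z hz
  rw [ContinuousWithinAt, tendsto_iff_dist_tendsto_zero]
  refine squeeze_zero' (Eventually.of_forall fun _ => dist_nonneg)
    (g := fun z' => densityLipschitzConstant * dist z' z) ?_ ?_
  · filter_upwards [eventually_sameCell hz, self_mem_nhdsWithin] with z' hc hz'
    exact dist_realDensity_le hz' hz hc.symm
  · have h : Continuous fun z' : ℂ => (densityLipschitzConstant : ℝ) * dist z' z := by fun_prop
    have := (h.tendsto z).mono_left (nhdsWithin_le_nhds (s := dissectedSquare))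
    simpa using this

lemma hurwitzMeasure_eq_withDensity : hurwitzMeasure =
    (volume.restrict hurwitzSquare).withDensity fun z => ENNReal.ofReal (realDensity z) := by
  rw [hurwitzMeasure, Measure.restrict_congr_set dissectedSquare_ae_eq.symm]
  refine withDensity_congr_ae ?_
  filter_upwards [ae_restrict_mem measurableSet_dissectedSquare] with z hz
  rw [realDensity_of_mem hz, ENNReal.ofReal_toReal (hurwitzDensity_lt_top hz).ne]

lemma isHurwitzDensity_realDensity : IsHurwitzDensity hurwitzMeasure realDensity where
  measurable := measurable_realDensity
  nonneg := realDensity_nonneg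
  eq_withDensity := hurwitzMeasure_eq_withDensity
  continuousOn := continuousOn_realDensity

/-! ### The density near the origin -/

lemma mem_quadrantRegion_iff {s t : ℝ} {z : ℂ} : z ∈ quadrantRegion s t ↔
    (|z.re| < 1 / 2 ∧ |z.im| < 1 / 2) ∧ (z.re - s) ^ 2 + z.im ^ 2 < 1 ∧
      z.re ^ 2 + (z.im - t) ^ 2 < 1 ∧ 1 < (z.re - s) ^ 2 + (z.im - t) ^ 2 := by
  unfold quadrantRegion
  rw [interior_hurwitzSquare]
  simp only [Set.mem_ofPred_eq, norm_lt_one_iff_sq, one_lt_norm_iff_sq]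
  simp

lemma quadrantRegion_one_one_subset : quadrantRegion 1 1 ⊆ dissectedSquare := by
  intro z hz
  obtain ⟨⟨h1, h2⟩, h3, h4, h5⟩ := mem_quadrantRegion_iff.1 hz
  refine mem_dissectedSquare_iff.2 ⟨h1, h2, fun m n h => ?_⟩
  obtain ⟨⟨hm1, hm2⟩, hn1, hn2⟩ := latticeDistSq_le_one h1 h2 h.le
  rw [abs_lt] at h1 h2
  unfold latticeDistSq at h
  interval_cases m <;> interval_cases n <;> push_cast at h <;> nlinarith

lemma sameCell_of_mem_quadrantRegion {z z' : ℂ} (hz : z ∈ quadrantRegion 1 1)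
    (hz' : z' ∈ quadrantRegion 1 1) : SameCell z z' := by
  have key {w : ℂ} (hw : w ∈ quadrantRegion 1 1) (m n : ℤ) :
      latticeDistSq w m n < 1 ↔ (m = 0 ∧ n = 0) ∨ (m = 1 ∧ n = 0) ∨ (m = 0 ∧ n = 1) := by
    obtain ⟨-, h3, h4, h5⟩ := mem_quadrantRegion_iff.1 hw
    refine latticeDistSq_lt_iff_of_wedge (quadrantRegion_one_one_subset hw) (by simp) (by simp)
      ?_ ?_ ?_ m n <;> unfold latticeDistSq <;> push_cast <;> linarith
  intro m n
  rw [key hz, key hz']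

lemma I_mul_mem_quadrantRegion {s t : ℝ} {z : ℂ} (hz : z ∈ quadrantRegion s t) :
    I * z ∈ quadrantRegion (-t) s := by
  rw [mem_quadrantRegion_iff] at *
  obtain ⟨⟨h1, h2⟩, h3, h4, h5⟩ := hz
  simp only [mul_re, mul_im, I_re, I_im, zero_mul, one_mul, zero_sub, zero_add, abs_neg]
  refine ⟨⟨h2, h1⟩, ?_, ?_, ?_⟩ <;> linarith

/-- On one quadrant region the density is Lipschitz; the value at 0 of a Lipschitz extension to the
plane is the limit, with a linear error. Rotation by `i` transports the estimate to the other three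
regions. -/
lemma exists_limit_realDensity : ∃ C : ℝ, 0 < C ∧ ∀ s ∈ ({1, -1} : Set ℝ),
    ∀ t ∈ ({1, -1} : Set ℝ), ∀ z ∈ quadrantRegion s t,
      |realDensity z - C| ≤ densityLipschitzConstant * ‖z‖ := by
  have hL : LipschitzOnWith densityLipschitzConstant realDensity (quadrantRegion 1 1) :=
    LipschitzOnWith.of_dist_le_mul fun z hz z' hz' =>
      dist_realDensity_le (quadrantRegion_one_one_subset hz) (quadrantRegion_one_one_subset hz')
        (sameCell_of_mem_quadrantRegion hz hz')
  obtain ⟨g, hg, hgeq⟩ := hL.extend_real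
  have h11 : ∀ z ∈ quadrantRegion 1 1,
      |realDensity z - g 0| ≤ densityLipschitzConstant * ‖z‖ := by
    intro z hz
    have := hg.dist_le_mul z 0
    rwa [← hgeq hz, Real.dist_eq, dist_zero_right] at this
  have hrot {s t : ℝ} (h : ∀ z ∈ quadrantRegion (-t) s,
      |realDensity z - g 0| ≤ densityLipschitzConstant * ‖z‖) :
      ∀ z ∈ quadrantRegion s t, |realDensity z - g 0| ≤ densityLipschitzConstant * ‖z‖ := by
    intro z hz
    have := h _ (I_mul_mem_quadrantRegion hz)
    rwa [realDensity_I_mul, norm_mul, norm_I, one_mul] at this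
  have h12 := hrot (s := 1) (t := -1) (by simpa using h11)
  have h22 := hrot (s := -1) (t := -1) (by simpa using h12)
  have h21 := hrot (s := -1) (t := 1) h22
  refine ⟨g 0, ?_, ?_⟩
  · have hη : 0 < minorant.toReal := ENNReal.toReal_pos minorant_pos.ne' minorant_ne_top
    by_contra hC
    set η := minorant.toReal
    set L : ℝ := (densityLipschitzConstant : ℝ)
    have hL0 : 0 ≤ L := NNReal.coe_nonneg _
    -- At `δ + δi` the density is at least `η` but at most the limit plus `2 L δ ≤ η / 2`, so the
    -- limit cannot be nonpositive.
    set δ := min (1 / 4) (η / (4 * (L + 1))) with hδ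
    have hδ0 : 0 < δ := lt_min (by norm_num) (by positivity)
    have hδ1 : δ ≤ 1 / 4 := min_le_left _ _
    have hδ2 : δ * (4 * (L + 1)) ≤ η := (le_div_iff₀ (by positivity)).1 (min_le_right _ _)
    have hmem : (⟨δ, δ⟩ : ℂ) ∈ quadrantRegion 1 1 := by
      rw [mem_quadrantRegion_iff]
      simp only [abs_of_pos hδ0]
      refine ⟨⟨by linarith, by linarith⟩, ?_, ?_, ?_⟩ <;> nlinarith
    have h1 := (abs_le.1 (h11 _ hmem)).2
    have h2 := minorant_le_realDensity (quadrantRegion_one_one_subset hmem)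
    have h3 : ‖(⟨δ, δ⟩ : ℂ)‖ ≤ 2 * δ := by
      have := norm_le_abs_re_add_abs_im (⟨δ, δ⟩ : ℂ)
      simp only [abs_of_pos hδ0] at this
      linarith
    have h4 : L * ‖(⟨δ, δ⟩ : ℂ)‖ ≤ L * (2 * δ) := mul_le_mul_of_nonneg_left h3 hL0
    nlinarith
  · rintro s (rfl | rfl) t (rfl | rfl)
    exacts [h11, h12, h21, h22]

/-! ### The tail of the first digit -/

lemma volume_box (a b : ℝ) : volume {z : ℂ | |z.re| ≤ a ∧ |z.im| ≤ b} =
    ENNReal.ofReal (2 * a) * ENNReal.ofReal (2 * b) := by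
  have h : {z : ℂ | |z.re| ≤ a ∧ |z.im| ≤ b} =
      measurableEquivRealProd ⁻¹' (Set.Icc (-a) a ×ˢ Set.Icc (-b) b) := by
    ext z; simp [abs_le]; tauto
  rw [h, volume_preserving_equiv_real_prod.measure_preimage_equiv, Measure.volume_eq_prod,
    Measure.prod_prod, Real.volume_Icc, Real.volume_Icc]
  ring_nf

/-- A neighbourhood of the part of the disk of radius `r` that the quadrant regions omit. -/
def axisStrip (r : ℝ) : Set ℂ :=
  {z | |z.re| ≤ r ^ 2 ∧ |z.im| ≤ r} ∪ {z | |z.re| ≤ r ∧ |z.im| ≤ r ^ 2}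

lemma measurableSet_axisStrip (r : ℝ) : MeasurableSet (axisStrip r) := by
  have h (a b : ℝ) : MeasurableSet {z : ℂ | |z.re| ≤ a ∧ |z.im| ≤ b} := by
    have e : {z : ℂ | |z.re| ≤ a ∧ |z.im| ≤ b} = {z : ℂ | |z.re| ≤ a} ∩ {z : ℂ | |z.im| ≤ b} := by
      ext; simp
    rw [e]
    exact (measurableSet_le (by fun_prop) measurable_const).inter
      (measurableSet_le (by fun_prop) measurable_const)
  exact (h _ _).union (h _ _)

lemma volume_axisStrip_le {r : ℝ} (hr : 0 < r) :
    volume (axisStrip r) ≤ ENNReal.ofReal (8 * r ^ 3) := by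
  refine (measure_union_le _ _).trans ?_
  rw [volume_box, volume_box, ← ENNReal.ofReal_mul (by positivity),
    ← ENNReal.ofReal_mul (by positivity), ← ENNReal.ofReal_add (by positivity) (by positivity)]
  exact ENNReal.ofReal_le_ofReal (by nlinarith)

lemma volume_real_axisStrip_le {r : ℝ} (hr : 0 < r) : volume.real (axisStrip r) ≤ 8 * r ^ 3 :=
  ENNReal.toReal_le_of_le_ofReal (by positivity) (volume_axisStrip_le hr)

/-- Off the strips `|z|² < r² < |x|, |y|`, which puts `z` in the discs about `s` and `ti` for the
signs `s`, `t` of its coordinates; `r ≤ 1 / 4` keeps it outside the disc about `s + ti`. -/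
lemma exists_mem_quadrantRegion {r : ℝ} (hr : r ≤ 1 / 4) {z : ℂ} (hz : ‖z‖ < r)
    (hs : z ∉ axisStrip r) :
    ∃ s ∈ ({1, -1} : Set ℝ), ∃ t ∈ ({1, -1} : Set ℝ), z ∈ quadrantRegion s t := by
  have hr0 : 0 < r := (norm_nonneg z).trans_lt hz
  have h1 := abs_re_le_norm z
  have h2 := abs_im_le_norm z
  have h3 : z.re ^ 2 + z.im ^ 2 < r ^ 2 := by
    rw [← norm_sq_eq]
    exact pow_lt_pow_left₀ hz (norm_nonneg z) two_ne_zero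
  simp only [axisStrip, Set.mem_union, Set.mem_ofPred_eq, not_or, not_and_or, not_le] at hs
  have h4 : r ^ 2 < |z.re| := hs.1.resolve_right (by linarith)
  have h5 : r ^ 2 < |z.im| := hs.2.resolve_left (by linarith)
  have hsign (x : ℝ) : ∃ s ∈ ({1, -1} : Set ℝ), s ^ 2 = 1 ∧ x * s = |x| := by
    rcases le_total 0 x with h | h
    · exact ⟨1, by simp, by norm_num, by rw [abs_of_nonneg h, mul_one]⟩
    · exact ⟨-1, by simp, by norm_num, by rw [abs_of_nonpos h]; ring⟩
  obtain ⟨s, hs1, hs2, hs3⟩ := hsign z.re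
  obtain ⟨t, ht1, ht2, ht3⟩ := hsign z.im
  refine ⟨s, hs1, t, ht1, mem_quadrantRegion_iff.2 ⟨⟨by linarith, by linarith⟩, ?_, ?_, ?_⟩⟩ <;>
    nlinarith [sq_nonneg z.re, sq_nonneg z.im]

lemma hurwitzMeasure_compl_dissectedSquare : hurwitzMeasure dissectedSquareᶜ = 0 :=
  isHurwitzMeasure_hurwitzMeasure.measure_dissectedSquare_compl

lemma ae_hurwitzMeasure_mem : ∀ᵐ z ∂hurwitzMeasure, z ∈ dissectedSquare :=
  hurwitzMeasure_compl_dissectedSquare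

lemma ball_subset_hurwitzSquare {r : ℝ} (hr : r ≤ 1 / 4) : Metric.ball (0 : ℂ) r ⊆ hurwitzSquare := by
  intro z hz
  rw [mem_ball_zero_iff] at hz
  have h1 := abs_le.1 (abs_re_le_norm z)
  have h2 := abs_le.1 (abs_im_le_norm z)
  exact ⟨⟨by linarith, by linarith⟩, by linarith, by linarith⟩

lemma hurwitzMeasure_real_ball {r : ℝ} (hr : r ≤ 1 / 4) :
    hurwitzMeasure.real (Metric.ball 0 r) = ∫ z in Metric.ball 0 r, realDensity z := by
  rw [integral_eq_lintegral_of_nonneg_ae (Eventually.of_forall realDensity_nonneg)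
    measurable_realDensity.aestronglyMeasurable, Measure.real, hurwitzMeasure_eq_withDensity,
    withDensity_apply _ measurableSet_ball, Measure.restrict_restrict measurableSet_ball,
    Set.inter_eq_left.2 (ball_subset_hurwitzSquare hr)]

/-- On the quadrant regions the density differs from `C` by at most `L r`, over area `π r²`; on the
strips it is merely bounded, over area at most `8 r³`. -/
lemma abs_hurwitzMeasure_ball_sub_le {C : ℝ} (hC : 0 < C)
    (hlim : ∀ s ∈ ({1, -1} : Set ℝ), ∀ t ∈ ({1, -1} : Set ℝ), ∀ z ∈ quadrantRegion s t,
      |realDensity z - C| ≤ densityLipschitzConstant * ‖z‖) :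
    ∃ K : ℝ, 0 ≤ K ∧ ∀ r : ℝ, 0 < r → r ≤ 1 / 4 →
      |hurwitzMeasure.real (Metric.ball 0 r) - Real.pi * C * r ^ 2| ≤ K * r ^ 3 := by
  set L : ℝ := (densityLipschitzConstant : ℝ)
  have hL : 0 ≤ L := NNReal.coe_nonneg _
  set D : ℝ := minorant⁻¹.toReal
  have hD : 0 ≤ D := ENNReal.toReal_nonneg
  refine ⟨L * Real.pi + (D + C) * 8, by positivity, fun r hr hr4 => ?_⟩
  have hvol : volume.real (Metric.ball (0 : ℂ) r) = Real.pi * r ^ 2 := by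
    rw [Measure.real, Complex.volume_ball]
    simp [hr.le, mul_comm]
  have hfin : volume (Metric.ball (0 : ℂ) r) ≠ ∞ := measure_ball_lt_top.ne
  have hint : IntegrableOn realDensity (Metric.ball 0 r) :=
    Measure.integrableOn_of_bounded hfin measurable_realDensity.aestronglyMeasurable (M := D)
      (Eventually.of_forall fun z => by
        rw [Real.norm_of_nonneg (realDensity_nonneg z)]; exact realDensity_le z)
  have hSfin : volume (axisStrip r) ≠ ∞ := ((volume_axisStrip_le hr).trans_lt ENNReal.ofReal_lt_top).ne
  have hSint : Integrable ((axisStrip r).indicator fun _ => D + C) :=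
    (integrable_indicator_iff (measurableSet_axisStrip r)).2 (integrableOn_const hSfin)
  have hconst (c : ℝ) : IntegrableOn (fun _ : ℂ => c) (Metric.ball 0 r) := integrableOn_const hfin
  have hpt (z : ℂ) (hz : z ∈ Metric.ball (0 : ℂ) r) :
      ‖realDensity z - C‖ ≤ L * r + (axisStrip r).indicator (fun _ => D + C) z := by
    rw [mem_ball_zero_iff] at hz
    rw [Real.norm_eq_abs]
    by_cases hs : z ∈ axisStrip r
    · rw [Set.indicator_of_mem hs, abs_le]
      have h1 := realDensity_nonneg z
      have h2 : realDensity z ≤ D := realDensity_le z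
      have h3 : 0 ≤ L * r := by positivity
      constructor <;> linarith
    · rw [Set.indicator_of_notMem hs, add_zero]
      obtain ⟨s, hs1, t, ht1, hq⟩ := exists_mem_quadrantRegion hr4 hz hs
      exact (hlim s hs1 t ht1 z hq).trans (mul_le_mul_of_nonneg_left hz.le hL)
  have h1 : hurwitzMeasure.real (Metric.ball 0 r) - Real.pi * C * r ^ 2 =
      ∫ z in Metric.ball 0 r, (realDensity z - C) := by
    rw [integral_sub hint (hconst C), hurwitzMeasure_real_ball hr4, setIntegral_const, hvol]
    simp only [smul_eq_mul]
    ring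
  rw [h1, ← Real.norm_eq_abs]
  calc ‖∫ z in Metric.ball 0 r, (realDensity z - C)‖
      ≤ ∫ z in Metric.ball 0 r, (L * r + (axisStrip r).indicator (fun _ => D + C) z) :=
        norm_integral_le_of_norm_le ((hconst _).add hSint.integrableOn)
          ((ae_restrict_mem measurableSet_ball).mono hpt)
    _ = Real.pi * r ^ 2 * (L * r) +
        ∫ z in Metric.ball 0 r, (axisStrip r).indicator (fun _ => D + C) z := by
        rw [integral_add (hconst _) hSint.integrableOn, setIntegral_const, hvol, smul_eq_mul]
    _ ≤ Real.pi * r ^ 2 * (L * r) + ∫ z, (axisStrip r).indicator (fun _ => D + C) z := by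
        refine add_le_add le_rfl (setIntegral_le_integral hSint (Eventually.of_forall fun z => ?_))
        exact Set.indicator_nonneg (fun _ _ => by positivity) z
    _ = Real.pi * r ^ 2 * (L * r) + volume.real (axisStrip r) * (D + C) := by
        rw [integral_indicator (measurableSet_axisStrip r), setIntegral_const, smul_eq_mul]
    _ ≤ Real.pi * r ^ 2 * (L * r) + 8 * r ^ 3 * (D + C) := by
        gcongr
        exact volume_real_axisStrip_le hr
    _ = _ := by ring

lemma hurwitzDigit_one {z : ℂ} (hz : z ∈ dissectedSquare) :
    hurwitzDigit z 1 = nearestGaussian (1 / z) := by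
  obtain ⟨h1, h2, -⟩ := mem_dissectedSquare_iff.1 hz
  have h := nearestGaussian_add h1 h2 0
  have h0 : latticePoint 0 = 0 := by simp [latticePoint]
  rw [h0, zero_add] at h
  simp [hurwitzDigit, h]

lemma norm_sub_nearestGaussian_le (u : ℂ) : ‖u - nearestGaussian u‖ ≤ 1 := by
  refine (norm_le_abs_re_add_abs_im _).trans ?_
  have h1 : (u - nearestGaussian u).re = u.re - ⌈u.re - 1 / 2⌉ := by simp [nearestGaussian]
  have h2 : (u - nearestGaussian u).im = u.im - ⌈u.im - 1 / 2⌉ := by simp [nearestGaussian]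
  rw [h1, h2]
  have e1 := Int.le_ceil (u.re - 1 / 2)
  have e2 := Int.ceil_lt_add_one (u.re - 1 / 2)
  have e3 := Int.le_ceil (u.im - 1 / 2)
  have e4 := Int.ceil_lt_add_one (u.im - 1 / 2)
  have a1 : |u.re - ⌈u.re - 1 / 2⌉| ≤ 1 / 2 := abs_le.2 ⟨by linarith, by linarith⟩
  have a2 : |u.im - ⌈u.im - 1 / 2⌉| ≤ 1 / 2 := abs_le.2 ⟨by linarith, by linarith⟩
  linarith

lemma ne_zero_of_mem_dissectedSquare {z : ℂ} (hz : z ∈ dissectedSquare) : z ≠ 0 := by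
  rintro rfl
  exact (mem_dissectedSquare_iff.1 hz).2.2 1 0 (by simp [latticeDistSq])

/-- The digit differs from `1 / z` by at most 1, so a digit of modulus above `j` forces `|1 / z| > j
- 1`. The reverse comparison, with `j + 1`, follows in the next lemma. -/
lemma measure_digit_le {j : ℝ} (hj : 1 < j) :
    hurwitzMeasure.real {z ∈ hurwitzSquare | j < ‖hurwitzDigit z 1‖} ≤
      hurwitzMeasure.real (Metric.ball 0 (1 / (j - 1))) := by
  refine ENNReal.toReal_mono (measure_ne_top _ _) (measure_mono_ae ?_)
  filter_upwards [ae_hurwitzMeasure_mem] with z hz hzj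
  have hzj2 : j < ‖hurwitzDigit z 1‖ := hzj.2
  rw [hurwitzDigit_one hz] at hzj2
  change z ∈ Metric.ball 0 (1 / (j - 1))
  have h0 := norm_pos_iff.2 (ne_zero_of_mem_dissectedSquare hz)
  have h1 := norm_sub_nearestGaussian_le (1 / z)
  have h2 := norm_sub_norm_le (nearestGaussian (1 / z)) (1 / z)
  rw [norm_sub_rev] at h2
  have h3 : j - 1 < 1 / ‖z‖ := by
    rw [norm_div, norm_one] at h2
    linarith
  rw [mem_ball_zero_iff, lt_div_iff₀ (by linarith)]
  rw [lt_div_iff₀ h0] at h3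
  linarith

lemma le_measure_digit {j : ℝ} (hj : 1 < j) :
    hurwitzMeasure.real (Metric.ball 0 (1 / (j + 1))) ≤
      hurwitzMeasure.real {z ∈ hurwitzSquare | j < ‖hurwitzDigit z 1‖} := by
  refine ENNReal.toReal_mono (measure_ne_top _ _) (measure_mono_ae ?_)
  filter_upwards [ae_hurwitzMeasure_mem] with z hz hzj
  refine ⟨dissectedSquare_subset hz, ?_⟩
  have hzj2 : z ∈ Metric.ball (0 : ℂ) (1 / (j + 1)) := hzj
  change j < ‖hurwitzDigit z 1‖
  rw [hurwitzDigit_one hz]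
  have h0 := norm_pos_iff.2 (ne_zero_of_mem_dissectedSquare hz)
  rw [mem_ball_zero_iff, lt_div_iff₀ (by linarith)] at hzj2
  have h1 := norm_sub_nearestGaussian_le (1 / z)
  have h2 := norm_sub_norm_le (1 / z) (nearestGaussian (1 / z))
  have h3 : j + 1 < 1 / ‖z‖ := by
    rw [lt_div_iff₀ h0]
    linarith
  rw [norm_div, norm_one] at h2
  linarith

lemma isBigO_measure_digit {H K : ℝ} (hH : 0 ≤ H) (hK : 0 ≤ K)
    (h : ∀ r : ℝ, 0 < r → r ≤ 1 / 4 →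
      |hurwitzMeasure.real (Metric.ball 0 r) - H * r ^ 2| ≤ K * r ^ 3) :
    (fun j : ℝ => hurwitzMeasure.real {z ∈ hurwitzSquare | j < ‖hurwitzDigit z 1‖} - H / j ^ 2)
      =O[atTop] (fun j : ℝ => 1 / j ^ 3) := by
  refine Asymptotics.IsBigO.of_bound (4 * H + 8 * K) ?_
  -- For `j ≥ 8` both radii `1 / (j ± 1)` are below `1 / 4`, and replacing `j ± 1` by `j` costs at
  -- most `4 / j³` in the squares and a factor 8 in the cubes.
  filter_upwards [eventually_ge_atTop 8] with j hj
  have hj0 : 0 < j := by linarith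
  have hm0 : 0 < j - 1 := by linarith
  have hp0 : 0 < j + 1 := by linarith
  have h1 := (abs_le.1 (h (1 / (j - 1)) (by positivity)
    (one_div_le_one_div_of_le (by norm_num) (by linarith)))).2
  have h2 := (abs_le.1 (h (1 / (j + 1)) (by positivity)
    (one_div_le_one_div_of_le (by norm_num) (by linarith)))).1
  have h3 := measure_digit_le (j := j) (by linarith)
  have h4 := le_measure_digit (j := j) (by linarith)
  have e1 : (1 / (j - 1)) ^ 2 ≤ 1 / j ^ 2 + 4 * (1 / j ^ 3) := by
    rw [div_pow, one_pow, show 1 / j ^ 2 + 4 * (1 / j ^ 3) = (j + 4) / j ^ 3 by field_simp,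
      div_le_div_iff₀ (by positivity) (by positivity)]
    nlinarith
  have e2 : (1 / (j - 1)) ^ 3 ≤ 8 * (1 / j ^ 3) := by
    rw [show 8 * (1 / j ^ 3) = (2 / j) ^ 3 by field_simp; norm_num]
    refine pow_le_pow_left₀ (by positivity) ?_ 3
    rw [div_le_div_iff₀ hm0 hj0]
    linarith
  have e3 : 1 / j ^ 2 - 4 * (1 / j ^ 3) ≤ (1 / (j + 1)) ^ 2 := by
    rw [div_pow, one_pow, show 1 / j ^ 2 - 4 * (1 / j ^ 3) = (j - 4) / j ^ 3 by field_simp,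
      div_le_div_iff₀ (by positivity) (by positivity)]
    nlinarith
  have e4 : (1 / (j + 1)) ^ 3 ≤ 8 * (1 / j ^ 3) := by
    have : (1 / (j + 1)) ^ 3 ≤ (1 / j) ^ 3 :=
      pow_le_pow_left₀ (by positivity) (one_div_le_one_div_of_le hj0 (by linarith)) 3
    have h5 : 0 < 1 / j ^ 3 := by positivity
    rw [div_pow 1 j, one_pow] at this
    linarith
  have f1 := mul_le_mul_of_nonneg_left e1 hH
  have f2 := mul_le_mul_of_nonneg_left e2 hK
  have f3 := mul_le_mul_of_nonneg_left e3 hH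
  have f4 := mul_le_mul_of_nonneg_left e4 hK
  have hdiv : H / j ^ 2 = H * (1 / j ^ 2) := by ring
  rw [Real.norm_eq_abs, Real.norm_of_nonneg (by positivity), hdiv, abs_le]
  constructor <;> nlinarith

theorem lemma3p2 :
    (∃! μ : Measure ℂ, IsHurwitzMeasure μ) ∧
    ∀ μ : Measure ℂ, IsHurwitzMeasure μ →
      ∃ (ρ : ℂ → ℝ) (C H : ℝ),
        IsHurwitzDensity μ ρ ∧
        (∀ s ∈ ({1, -1} : Set ℝ), ∀ t ∈ ({1, -1} : Set ℝ),
          Tendsto ρ (𝓝[quadrantRegion s t] 0) (𝓝 C)) ∧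
        0 < H ∧ H = Real.pi * C ∧
        (fun j : ℝ => μ.real {z ∈ hurwitzSquare | j < ‖hurwitzDigit z 1‖} - H / j ^ 2)
          =O[atTop] (fun j : ℝ => 1 / j ^ 3) := by
  refine ⟨⟨hurwitzMeasure, isHurwitzMeasure_hurwitzMeasure, fun ν hν => hν.eq_hurwitzMeasure⟩,
    fun μ hμ => ?_⟩
  obtain rfl := hμ.eq_hurwitzMeasure
  obtain ⟨C, hC, hlim⟩ := exists_limit_realDensity
  obtain ⟨K, hK, hball⟩ := abs_hurwitzMeasure_ball_sub_le hC hlim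
  have hH : 0 < Real.pi * C := mul_pos Real.pi_pos hC
  refine ⟨realDensity, C, Real.pi * C, isHurwitzDensity_realDensity, fun s hs t ht => ?_, hH, rfl,
    isBigO_measure_digit hH.le hK hball⟩
  rw [tendsto_iff_norm_sub_tendsto_zero]
  refine squeeze_zero' (g := fun z => densityLipschitzConstant * ‖z‖)
    (Eventually.of_forall fun _ => norm_nonneg _)
    (eventually_mem_nhdsWithin.mono fun z hz => hlim s hs t ht z hz) ?_
  have h : Continuous fun z : ℂ => (densityLipschitzConstant : ℝ) * ‖z‖ := by fun_prop
  have := (h.tendsto 0).mono_left (nhdsWithin_le_nhds (s := quadrantRegion s t))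
  simpa using this
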